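/- Let $\omega$ be a radial weight on the open unit disk $\mathbb D$, that is, a continuous, strictly positive function with $\omega(z)=\omega(|z|)$ for $z\in\mathbb D$ and $\int_{\mathbb D}\omega\,dm<+\infty$, where $dm(z)=\pi^{-1}\,dx\,dy$. Put $$\Omega(n)=\int_{\mathbb D}|z|^{2n}\,\omega(z)\,dm(z)\quad(n=0,1,2,\ldots),\qquad \Omega(n)=\frac1{\Omega(-n-1)}\quad(n=-1,-2,-3,\ldots),$$ and let $\mathfrak L^2(\mathbb T,\omega)$ be the Hilbert space of formal Laurent series $h(z)=\sum_{n\in\mathbb Z}c_nz^n$ with complex coefficients and $$\|h\|^2=\sum_{n\in\mathbb Z}|c_n|^2\,\Omega(n)<+\infty .$$ The bilateral shift $\mathbf S h(z)=z\,h(z)=\sum_{n\in\mathbb Z}c_{n-1}z^n$ is a bounded invertible operator on $\mathfrak L^2(\mathbb T,\omega)$. A subspace $\mathcal N$ of $\mathfrak L^2(\mathbb T,\omega)$ is called bilaterally shift invariant if it is a closed linear subspace with $\mathbf S\mathcal N\subseteq\mathcal N$ and $\mathbf S^{-1}\mathcal N\subseteq\mathcal N$; in that case let $\mathbf S[\mathcal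 N]$ be the bounded operator on the quotient space $\mathfrak L^2(\mathbb T,\omega)/\mathcal N$ given by $\mathbf S[\mathcal N](f+\mathcal N)=\mathbf S f+\mathcal N$. **Theorem.** Let $\mathcal N$ be a bilaterally shift invariant subspace of $\mathfrak L^2(\mathbb T,\omega)$. Then the spectrum $\sigma(\mathbf S[\mathcal N])$ is a perfect set, that is, a (possibly empty) closed subset of the unit circle $\mathbb T=\{\lambda\in\mathbb C:|\lambda|=1\}$ without isolated points. In particular, if $\sigma(\mathbf S[\mathcal N])$ is countable (finite or empty included), then $\sigma(\mathbf S[\mathcal N])=\emptyset$ and $\mathcal N=\mathfrak L^2(\mathbb T,\omega)$. -/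

import Mathlib

/-- A radial weight on the open unit disk `𝔻 = ball 0 1`: a continuous, strictly positive,
area-summable function on `𝔻` with `ω z = ω |z|`. (The values of `ω` off the disk play no role.) -/
structure RadialWeight where
  toFun : ℂ → ℝ
  continuousOn : ContinuousOn toFun (Metric.ball 0 1)
  pos : ∀ z ∈ Metric.ball (0 : ℂ) 1, 0 < toFun z
  integrableOn : MeasureTheory.IntegrableOn toFun (Metric.ball 0 1)
  radial : ∀ z ∈ Metric.ball (0 : ℂ) 1, toFun z = toFun (‖z‖ : ℂ)

namespace RadialWeight

/-- The moment `∫_𝔻 |z|^{2n} ω(z) dm(z)`, where `dm = π⁻¹ dx dy` is normalized area measure. -/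
noncomputable def moment (ω : RadialWeight) (n : ℕ) : ℝ :=
  Real.pi⁻¹ * ∫ z in Metric.ball (0 : ℂ) 1, ‖z‖ ^ (2 * n) * ω.toFun z

/-- The weight sequence on `ℤ`: the moments of `ω` for `n ≥ 0`, extended antisymmetrically by
`Ω n = 1 / Ω (-n-1)` for `n < 0` (note that `Int.negSucc k` is the integer `-k-1`). -/
noncomputable def Omega (ω : RadialWeight) : ℤ → ℝ
  | Int.ofNat n => ω.moment n
  | Int.negSucc n => 1 / ω.moment n

theorem integrableOn_poly_mul (ω : RadialWeight) {g : ℂ → ℝ} (hg : Continuous g) :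
    MeasureTheory.IntegrableOn (fun z => g z * ω.toFun z) (Metric.ball 0 1) := by
  obtain ⟨C, hC⟩ := (isCompact_closedBall (0 : ℂ) 1).exists_bound_of_continuousOn hg.continuousOn
  refine MeasureTheory.Integrable.bdd_mul (c := C) ω.integrableOn
    hg.aestronglyMeasurable ?_
  filter_upwards [MeasureTheory.ae_restrict_mem Metric.isOpen_ball.measurableSet] with z hz
  exact hC z (Metric.ball_subset_closedBall hz)

theorem moment_pos (ω : RadialWeight) (n : ℕ) : 0 < ω.moment n := by
  refine mul_pos (inv_pos.2 Real.pi_pos) ?_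
  rw [MeasureTheory.setIntegral_pos_iff_support_of_nonneg_ae]
  · have hsub : Metric.ball (0 : ℂ) 1 \ {0} ⊆
        (Function.support fun z => ‖z‖ ^ (2 * n) * ω.toFun z) ∩ Metric.ball 0 1 := by
      rintro z ⟨hz, hz0⟩
      have hz0' : z ≠ 0 := hz0
      exact ⟨mul_ne_zero (pow_ne_zero _ (norm_ne_zero_iff.2 hz0')) (ω.pos z hz).ne', hz⟩
    refine lt_of_lt_of_le ?_ (MeasureTheory.measure_mono hsub)
    rw [MeasureTheory.measure_sdiff_null (by simp)]
    exact Metric.measure_ball_pos _ _ one_pos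
  · filter_upwards [MeasureTheory.ae_restrict_mem Metric.isOpen_ball.measurableSet] with z hz
    exact mul_nonneg (by positivity) (ω.pos z hz).le
  · exact ω.integrableOn_poly_mul (by fun_prop)

theorem moment_succ_le (ω : RadialWeight) (n : ℕ) : ω.moment (n + 1) ≤ ω.moment n := by
  refine mul_le_mul_of_nonneg_left ?_ (inv_pos.2 Real.pi_pos).le
  refine MeasureTheory.setIntegral_mono_on (ω.integrableOn_poly_mul (by fun_prop))
    (ω.integrableOn_poly_mul (by fun_prop)) Metric.isOpen_ball.measurableSet fun z hz => ?_
  refine mul_le_mul_of_nonneg_right ?_ (ω.pos z hz).le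
  have h1 : ‖z‖ < 1 := by simpa using hz
  exact pow_le_pow_of_le_one (norm_nonneg z) h1.le (by omega)

theorem moment_sq_le (ω : RadialWeight) (n : ℕ) :
    ω.moment (n + 1) ^ 2 ≤ ω.moment n * ω.moment (n + 2) := by
  have key : ∀ t : ℝ, 0 ≤ ω.moment (n + 2) - 2 * t * ω.moment (n + 1) + t ^ 2 * ω.moment n := by
    intro t
    have h0 := ω.integrableOn_poly_mul (g := fun z => ‖z‖ ^ (2 * n)) (by fun_prop)
    have h1 := ω.integrableOn_poly_mul (g := fun z => ‖z‖ ^ (2 * (n + 1))) (by fun_prop)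
    have h2 := ω.integrableOn_poly_mul (g := fun z => ‖z‖ ^ (2 * (n + 2))) (by fun_prop)
    have hnn : 0 ≤ ∫ z in Metric.ball (0 : ℂ) 1,
        (‖z‖ ^ (2 * n) * (‖z‖ ^ 2 - t) ^ 2) * ω.toFun z :=
      MeasureTheory.setIntegral_nonneg Metric.isOpen_ball.measurableSet fun z hz =>
        mul_nonneg (by positivity) (ω.pos z hz).le
    have heq : ∫ z in Metric.ball (0 : ℂ) 1,
        (‖z‖ ^ (2 * n) * (‖z‖ ^ 2 - t) ^ 2) * ω.toFun z =
        (∫ z in Metric.ball (0 : ℂ) 1, ‖z‖ ^ (2 * (n + 2)) * ω.toFun z)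
        - 2 * t * (∫ z in Metric.ball (0 : ℂ) 1, ‖z‖ ^ (2 * (n + 1)) * ω.toFun z)
        + t ^ 2 * ∫ z in Metric.ball (0 : ℂ) 1, ‖z‖ ^ (2 * n) * ω.toFun z := by
      have h1' := h1.const_mul (2 * t)
      have h0' := h0.const_mul (t ^ 2)
      have h21 := h2.sub h1'
      rw [← MeasureTheory.integral_const_mul, ← MeasureTheory.integral_const_mul,
        ← MeasureTheory.integral_sub h2 h1']
      refine Eq.trans ?_ (MeasureTheory.integral_add h21 h0')
      congr 1
      ext z
      ring
    rw [heq] at hnn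
    have := mul_nonneg (inv_pos.2 Real.pi_pos).le hnn
    unfold moment
    linarith
  have hp := ω.moment_pos n
  have h := key (ω.moment (n + 1) / ω.moment n)
  have h' := mul_nonneg hp.le h
  have e : ω.moment n * (ω.moment (n + 2) - 2 * (ω.moment (n + 1) / ω.moment n) *
      ω.moment (n + 1) + (ω.moment (n + 1) / ω.moment n) ^ 2 * ω.moment n) =
      ω.moment n * ω.moment (n + 2) - ω.moment (n + 1) ^ 2 := by
    field_simp
    ring
  linarith

theorem moment_ratio_le (ω : RadialWeight) (n : ℕ) :
    ω.moment n * ω.moment 1 ≤ ω.moment 0 * ω.moment (n + 1) := by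
  induction n with
  | zero => simp
  | succ k ih =>
    have h1 := ω.moment_sq_le k
    have hk := ω.moment_pos k
    have hk1 := ω.moment_pos (k + 1)
    have h0 := ω.moment_pos 0
    have : ω.moment k * ω.moment (k + 1) * (ω.moment (k + 1) * ω.moment 1) ≤
        ω.moment k * ω.moment (k + 1) * (ω.moment 0 * ω.moment (k + 2)) := by
      calc _ = ω.moment (k + 1) ^ 2 * (ω.moment k * ω.moment 1) := by ring
        _ ≤ (ω.moment k * ω.moment (k + 2)) * (ω.moment 0 * ω.moment (k + 1)) :=
          mul_le_mul h1 ih (mul_pos hk (ω.moment_pos 1)).le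
            (mul_pos hk (ω.moment_pos _)).le
        _ = _ := by ring
    exact le_of_mul_le_mul_left this (mul_pos hk hk1)

theorem Omega_pos (ω : RadialWeight) (n : ℤ) : 0 < ω.Omega n := by
  cases n with
  | ofNat n => exact ω.moment_pos n
  | negSucc n => exact one_div_pos.2 (ω.moment_pos n)

/-- Neighbouring values of `Ω` are comparable, so that both shifts are bounded. -/
theorem exists_Omega_le (ω : RadialWeight) :
    ∃ C : ℝ, 0 < C ∧ ∀ n : ℤ, ω.Omega (n + 1) ≤ C * ω.Omega n ∧ ω.Omega n ≤ C * ω.Omega (n + 1) := by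
  have p := ω.moment_pos
  set a := ω.moment 0 / ω.moment 1 with ha
  have hapos : 0 < a := div_pos (p 0) (p 1)
  set C := 1 + ω.moment 0 ^ 2 + a + 1 / ω.moment 0 ^ 2 with hC
  have hb : 0 < 1 / ω.moment 0 ^ 2 := by have := p 0; positivity
  have hc : 0 < ω.moment 0 ^ 2 := by have := p 0; positivity
  have h1C : 1 ≤ C := by linarith
  have haC : a ≤ C := by linarith
  have up : ∀ n, ω.moment (n + 1) ≤ C * ω.moment n := fun n =>
    (ω.moment_succ_le n).trans (le_mul_of_one_le_left (p n).le h1C)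
  have down : ∀ n, ω.moment n ≤ C * ω.moment (n + 1) := fun n => by
    have h : ω.moment n ≤ a * ω.moment (n + 1) := by
      rw [ha, div_mul_eq_mul_div, le_div_iff₀ (p 1)]
      exact ω.moment_ratio_le n
    exact h.trans (mul_le_mul_of_nonneg_right haC (p _).le)
  refine ⟨C, by linarith, fun n => ?_⟩
  match n with
  | Int.ofNat n => exact ⟨up n, down n⟩
  | Int.negSucc 0 =>
    have e : Int.negSucc 0 + 1 = Int.ofNat 0 := rfl
    rw [e]
    simp only [Omega]
    have h0 := p 0
    constructor
    · rw [mul_one_div, le_div_iff₀ h0]; nlinarith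
    · rw [div_le_iff₀ h0]
      have h2 : 1 / ω.moment 0 ^ 2 ≤ C := by linarith
      rw [div_le_iff₀ hc] at h2
      linarith
  | Int.negSucc (k + 1) =>
    have e : Int.negSucc (k + 1) + 1 = Int.negSucc k := rfl
    rw [e]
    simp only [Omega]
    have hu := up k
    have hd := down k
    constructor
    · rw [mul_one_div, div_le_div_iff₀ (p _) (p _)]; linarith
    · rw [mul_one_div, div_le_div_iff₀ (p _) (p _)]; linarith

end RadialWeight

/-- The formal Laurent series `h = ∑ cₙ zⁿ` (given by their coefficients) for which
`∑ |cₙ|² Ω(n) < ∞`, as a linear subspace of all formal Laurent series. -/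
def laurentSubmodule (ω : RadialWeight) : Submodule ℂ (ℤ → ℂ) where
  carrier := {c | Summable fun n => ‖c n‖ ^ 2 * ω.Omega n}
  zero_mem' := by simp [summable_zero]
  add_mem' := by
    intro a b ha hb
    refine Summable.of_nonneg_of_le (fun n => mul_nonneg (by positivity) (ω.Omega_pos n).le)
      (fun n => ?_) ((ha.add hb).mul_left 2)
    have h1 : ‖(a + b) n‖ ^ 2 ≤ 2 * (‖a n‖ ^ 2 + ‖b n‖ ^ 2) := by
      have h := norm_add_le (a n) (b n)
      have h' : ‖(a + b) n‖ ^ 2 ≤ (‖a n‖ + ‖b n‖) ^ 2 :=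
        pow_le_pow_left₀ (norm_nonneg _) h 2
      nlinarith [sq_nonneg (‖a n‖ - ‖b n‖)]
    nlinarith [mul_le_mul_of_nonneg_right h1 (ω.Omega_pos n).le]
  smul_mem' := by
    intro t a ha
    refine (Summable.mul_left (‖t‖ ^ 2) ha).congr fun n => ?_
    simp only [Pi.smul_apply, smul_eq_mul, norm_mul]
    ring

/-- The space `𝔏²(𝕋,ω)` of formal Laurent series `h = ∑ cₙ zⁿ` with
`‖h‖² = ∑ |cₙ|² Ω(n) < ∞`. -/
def LaurentL2 (ω : RadialWeight) : Type := laurentSubmodule ω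

namespace LaurentL2

variable {ω : RadialWeight}

instance : AddCommGroup (LaurentL2 ω) := inferInstanceAs (AddCommGroup (laurentSubmodule ω))

instance : Module ℂ (LaurentL2 ω) := inferInstanceAs (Module ℂ (laurentSubmodule ω))

/-- The Laurent coefficients of an element of `𝔏²(𝕋,ω)`. -/
def coeff (h : LaurentL2 ω) : ℤ → ℂ := h.1

theorem ext_coeff {f g : LaurentL2 ω} (h : ∀ n, f.coeff n = g.coeff n) : f = g :=
  Subtype.ext (funext h)

theorem coeff_add (f g : LaurentL2 ω) (n : ℤ) : (f + g).coeff n = f.coeff n + g.coeff n := rfl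

theorem coeff_smul (t : ℂ) (f : LaurentL2 ω) (n : ℤ) : (t • f).coeff n = t * f.coeff n := rfl

theorem summable_coeff (f : LaurentL2 ω) : Summable fun n => ‖f.coeff n‖ ^ 2 * ω.Omega n := f.2

noncomputable instance : Norm (LaurentL2 ω) :=
  ⟨fun h => √(∑' n : ℤ, ‖h.coeff n‖ ^ 2 * ω.Omega n)⟩

theorem norm_def (h : LaurentL2 ω) : ‖h‖ = √(∑' n : ℤ, ‖h.coeff n‖ ^ 2 * ω.Omega n) := rfl

theorem norm_core : NormedSpace.Core ℂ (LaurentL2 ω) where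
  norm_nonneg f := Real.sqrt_nonneg _
  norm_smul t f := by
    have h : ∀ n, ‖(t • f).coeff n‖ ^ 2 * ω.Omega n =
        ‖t‖ ^ 2 * (‖f.coeff n‖ ^ 2 * ω.Omega n) := fun n => by
      rw [coeff_smul, norm_mul]; ring
    rw [norm_def, norm_def]
    simp only [h]
    rw [tsum_mul_left, Real.sqrt_mul (sq_nonneg _), Real.sqrt_sq (norm_nonneg t)]
  norm_triangle f g := by
    have e : ∀ (k : LaurentL2 ω) (n : ℤ),
        ‖k.coeff n‖ ^ 2 * ω.Omega n = (‖k.coeff n‖ * √(ω.Omega n)) ^ (2 : ℝ) := fun k n => by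
      rw [Real.rpow_two, mul_pow, Real.sq_sqrt (ω.Omega_pos n).le]
    have hf := f.summable_coeff
    have hg := g.summable_coeff
    have hfg := (f + g).summable_coeff
    simp only [e] at hf hg hfg
    obtain ⟨hs, hle⟩ := Real.Lp_add_le_tsum_of_nonneg (p := 2) one_le_two
      (fun n => mul_nonneg (norm_nonneg (f.coeff n)) (Real.sqrt_nonneg (ω.Omega n)))
      (fun n => mul_nonneg (norm_nonneg (g.coeff n)) (Real.sqrt_nonneg (ω.Omega n))) hf hg
    rw [norm_def, norm_def, norm_def]
    simp only [e]
    rw [← Real.sqrt_eq_rpow, ← Real.sqrt_eq_rpow, ← Real.sqrt_eq_rpow] at hle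
    refine (Real.sqrt_le_sqrt (hfg.tsum_le_tsum (fun n => ?_) hs)).trans hle
    refine Real.rpow_le_rpow (by positivity) ?_ zero_le_two
    rw [← add_mul, coeff_add]
    exact mul_le_mul_of_nonneg_right (norm_add_le _ _) (Real.sqrt_nonneg _)
  norm_eq_zero_iff f := by
    have hnn : ∀ n, 0 ≤ ‖f.coeff n‖ ^ 2 * ω.Omega n := fun n =>
      mul_nonneg (by positivity) (ω.Omega_pos n).le
    rw [norm_def, Real.sqrt_eq_zero (tsum_nonneg hnn)]
    constructor
    · intro h
      have h0 := (f.summable_coeff.hasSum_iff.2 h)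
      have h1 := (hasSum_zero_iff_of_nonneg hnn).1 h0
      refine ext_coeff fun n => ?_
      have h2 : ‖f.coeff n‖ ^ 2 * ω.Omega n = 0 := congrFun h1 n
      have h3 : ‖f.coeff n‖ ^ 2 = 0 := (mul_eq_zero.1 h2).resolve_right (ω.Omega_pos n).ne'
      exact norm_eq_zero.1 (pow_eq_zero_iff two_ne_zero |>.1 h3)
    · rintro rfl
      have h0 : ∀ n, (0 : LaurentL2 ω).coeff n = 0 := fun _ => rfl
      simp [h0]

noncomputable instance : NormedAddCommGroup (LaurentL2 ω) := NormedAddCommGroup.ofCore norm_core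

noncomputable instance : NormedSpace ℂ (LaurentL2 ω) := NormedSpace.ofCore norm_core

/-- If `Ω` at the shifted index is at most `C * Ω`, translating the coefficients is bounded. -/
theorem translate_bound {C : ℝ} (m : ℤ) (hC : ∀ n, ω.Omega n ≤ C * ω.Omega (n - m))
    (f : LaurentL2 ω) :
    (Summable fun n => ‖f.coeff (n - m)‖ ^ 2 * ω.Omega n) ∧
      √(∑' n : ℤ, ‖f.coeff (n - m)‖ ^ 2 * ω.Omega n) ≤ √C * ‖f‖ := by
  have hs : Summable fun n => C * (‖f.coeff (n - m)‖ ^ 2 * ω.Omega (n - m)) :=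
    (((Equiv.subRight m).summable_iff
      (f := fun n => ‖f.coeff n‖ ^ 2 * ω.Omega n)).2 f.summable_coeff).mul_left C
  have hle : ∀ n, ‖f.coeff (n - m)‖ ^ 2 * ω.Omega n ≤
      C * (‖f.coeff (n - m)‖ ^ 2 * ω.Omega (n - m)) := fun n => by
    have := mul_le_mul_of_nonneg_left (hC n) (sq_nonneg ‖f.coeff (n - m)‖)
    linarith
  have hs' := Summable.of_nonneg_of_le
    (fun n => mul_nonneg (by positivity) (ω.Omega_pos n).le) hle hs
  have hC0 : 0 ≤ C := by
    have h := (ω.Omega_pos 0).le.trans (hC 0)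
    exact nonneg_of_mul_nonneg_left h (ω.Omega_pos _)
  refine ⟨hs', ?_⟩
  rw [norm_def, ← Real.sqrt_mul hC0]
  refine Real.sqrt_le_sqrt ((hs'.tsum_le_tsum hle hs).trans_eq ?_)
  rw [tsum_mul_left, ← (Equiv.subRight m).tsum_eq (fun n => ‖f.coeff n‖ ^ 2 * ω.Omega n)]
  rfl

theorem exists_translate_bound (ω : RadialWeight) : ∃ C : ℝ,
    (∀ n, ω.Omega n ≤ C * ω.Omega (n - 1)) ∧ (∀ n, ω.Omega n ≤ C * ω.Omega (n - (-1))) := by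
  obtain ⟨C, -, h⟩ := ω.exists_Omega_le
  refine ⟨C, fun n => ?_, fun n => ?_⟩
  · simpa using (h (n - 1)).1
  · simpa using (h n).2

/-- The linear operator multiplying a formal Laurent series by `z ^ m`, for `m = ± 1`:
the coefficient sequence `cₙ` becomes `cₙ₋ₘ`. -/
def translate (m : ℤ) (hm : ∃ C : ℝ, ∀ n, ω.Omega n ≤ C * ω.Omega (n - m)) :
    LaurentL2 ω →ₗ[ℂ] LaurentL2 ω where
  toFun f := ⟨fun n => f.coeff (n - m), by
    obtain ⟨C, hC⟩ := hm
    exact (translate_bound m hC f).1⟩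
  map_add' _ _ := rfl
  map_smul' _ _ := rfl

theorem continuous_translate (m : ℤ) (hm : ∃ C : ℝ, ∀ n, ω.Omega n ≤ C * ω.Omega (n - m)) :
    Continuous (translate m hm : LaurentL2 ω → LaurentL2 ω) := by
  obtain ⟨C, hC⟩ := id hm
  exact AddMonoidHomClass.continuous_of_bound (translate m hm) (√C)
    fun f => (translate_bound m hC f).2

/-- The bilateral shift `S : ∑ cₙ zⁿ ↦ ∑ cₙ₋₁ zⁿ` (multiplication by `z`), as an invertible
bounded operator on `𝔏²(𝕋,ω)`. Its inverse `S⁻¹` is the backward shift, `(shift ω).symm`. -/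
def shift (ω : RadialWeight) : LaurentL2 ω ≃L[ℂ] LaurentL2 ω where
  toLinearMap := translate 1 ((exists_translate_bound ω).imp fun _ h => h.1)
  invFun := translate (-1) ((exists_translate_bound ω).imp fun _ h => h.2)
  left_inv f := ext_coeff fun n => congrArg f.coeff (by ring : n - (-1) - 1 = n)
  right_inv f := ext_coeff fun n => congrArg f.coeff (by ring : n - 1 - (-1) = n)
  continuous_toFun := continuous_translate 1 _
  continuous_invFun := continuous_translate (-1) _

theorem coeff_shift (f : LaurentL2 ω) (n : ℤ) : (shift ω f).coeff n = f.coeff (n - 1) := rfl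

/-- A bilaterally (shift) invariant subspace: a closed linear subspace of `𝔏²(𝕋,ω)` invariant
under both the forward shift `S` and the backward shift `S⁻¹`. -/
structure IsBilaterallyInvariant (N : Submodule ℂ (LaurentL2 ω)) : Prop where
  isClosed : IsClosed (N : Set (LaurentL2 ω))
  shift_mem : ∀ f ∈ N, shift ω f ∈ N
  shift_symm_mem : ∀ f ∈ N, (shift ω).symm f ∈ N

/-- The operator `S[N]` induced by the shift on the quotient `𝔏²(𝕋,ω) ⧸ N`,
`S[N] (f + N) = S f + N`. -/
noncomputable def inducedShift (N : Submodule ℂ (LaurentL2 ω)) (hN : IsBilaterallyInvariant N) :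
    (LaurentL2 ω ⧸ N) →L[ℂ] (LaurentL2 ω ⧸ N) :=
  N.liftQL (N.mkQL.comp (shift ω : LaurentL2 ω →L[ℂ] LaurentL2 ω)) fun f hf =>
    (Submodule.Quotient.mk_eq_zero N).2 (hN.shift_mem f hf)

theorem inducedShift_mk (N : Submodule ℂ (LaurentL2 ω)) (hN : IsBilaterallyInvariant N)
    (f : LaurentL2 ω) :
    inducedShift N hN (Submodule.Quotient.mk f) = Submodule.Quotient.mk (shift ω f) := rfl

end LaurentL2

/-!
Let `T` be the operator induced by the shift on `E = 𝔏²(𝕋,ω) ⧸ N`. The powers of `S` and `S⁻¹` grow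
slower than every exponential, since the moments of `ω` decrease but stay above `c * s ^ m` for each
`s < 1`; hence the spectrum of `T` lies on the unit circle
(`LaurentL2.spectrum_inducedShift_subset_sphere`).

Suppose that `c` is an isolated point of the spectrum, and let `P` be the integral of the resolvent
of `T` over a small circle around `c`. For a bounded functional `φ` on `E` put
`b n = φ (P (zⁿ + N))`. Two facts about this sequence force `b 0 = 0`.

* The number `b n` is the integral of `zⁿ` times a fixed function holomorphic in a punctured disk
  around `c`, and the circle may be shrunk. Up to the rotation factor `cⁿ`, the sequence `b`
  therefore behaves like the restriction to `ℤ` of an entire function of exponential type zero.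
  This is recorded by bounds on finite differences (`IsZeroType`), a property that passes to
  products and to reflections, hence to `b n * b (-n)`, from which the rotation cancels.
* By Riesz representation `∑ |b n|² / Ω n < ∞`, and likewise for `φ ∘ T`. As
  `Ω n * Ω (-n-1) = 1`, the Cauchy-Schwarz inequality makes `b n * b (-n)` absolutely summable.

A summable zero type sequence `a` satisfies `a 0 = 0` (`IsZeroType.apply_zero_eq_zero`): its
generating functions inside and outside the unit disk continue each other across `𝕋 \ {1}`, and in
the coordinate `ζ = w / (1 + w)` they form an entire function of `w`, bounded by `∑ |a n|`, which
vanishes at `w = -1` and equals `a 0` at `w = 0`. So Liouville's theorem gives `b 0 ^ 2 = 0`. The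
same argument at the other monomials shows that `P` kills them all, so `P = 0`. But then `c - T` is
invertible (`mem_resolventSet_of_circleIntegral_resolvent_eq_zero`), so `c` is not in the spectrum.

A countable perfect set in `ℂ` is empty, and an operator with empty spectrum lives on the zero
space, so `N` is everything.
-/

/-! ### Sequences of zero type -/

open fwdDiff in
/-- A sequence `a : ℤ → G` is of zero type if it behaves like the restriction to `ℤ` of an entire
function of exponential type zero: for each `ε > 0` its `k`-th differences at `n` are
`O(ε ^ k (1 + ε) ^ |n|)`, uniformly in `k` and `n`. -/
def IsZeroType {G : Type*} [NormedAddCommGroup G] (a : ℤ → G) : Prop :=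
  ∀ ε > 0, ∃ C : ℝ, ∀ (k : ℕ) (n : ℤ), ‖(Δ_[1])^[k] a n‖ ≤ C * ε ^ k * (1 + ε) ^ n.natAbs

namespace IsZeroType

open fwdDiff

theorem norm_fwdDiff_iter_mul_le {ε : ℝ} (hε : 0 ≤ ε) (k : ℕ) :
    ∀ (b c : ℤ → ℂ) (B C : ℝ),
      (∀ (j : ℕ) (n : ℤ), ‖(Δ_[1])^[j] b n‖ ≤ B * ε ^ j * (1 + ε) ^ n.natAbs) →
      (∀ (j : ℕ) (n : ℤ), ‖(Δ_[1])^[j] c n‖ ≤ C * ε ^ j * (1 + ε) ^ n.natAbs) →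
      ∀ n : ℤ, ‖(Δ_[1])^[k] (fun m => b m * c m) n‖ ≤
        B * C * (ε * (2 + ε)) ^ k * (1 + ε * (2 + ε)) ^ n.natAbs := by
  have e2 : 1 + ε * (2 + ε) = (1 + ε) * (1 + ε) := by ring
  rw [e2]
  induction k with
  | zero =>
    intro b c B C hb hc n
    have h1 := hb 0 n
    have h2 := hc 0 n
    simp only [Function.iterate_zero, id_eq, pow_zero, mul_one, norm_mul] at h1 h2 ⊢
    calc _ ≤ (B * (1 + ε) ^ n.natAbs) * (C * (1 + ε) ^ n.natAbs) :=
          mul_le_mul h1 h2 (norm_nonneg _) ((norm_nonneg _).trans h1)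
      _ = _ := by rw [mul_pow]; ring
  | succ k ih =>
    intro b c B C hb hc n
    -- the Leibniz rule `Δ (b c) = (Δ b) · c (· + 1) + b · Δ c`
    have hD : Δ_[1] (fun m => b m * c m) =
        (fun m => Δ_[1] b m * c (m + 1)) + fun m => b m * Δ_[1] c m := by
      funext m; simp [fwdDiff]; ring
    have hC0 : 0 ≤ C := by
      have := (norm_nonneg _).trans (hc 0 0); simpa using this
    have s1 := ih (Δ_[1] b) (fun m => c (m + 1)) (B * ε) (C * (1 + ε))
      (fun j n => by rw [← Function.iterate_succ_apply]; refine (hb (j + 1) _).trans_eq ?_; ring)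
      (fun j n => by
        rw [fwdDiff_iter_comp_add]
        refine (hc j (n + 1)).trans ?_
        have : (1 + ε) ^ (n + 1).natAbs ≤ (1 + ε) ^ (n.natAbs + 1) :=
          pow_le_pow_right₀ (by linarith) (by omega)
        calc _ ≤ C * ε ^ j * (1 + ε) ^ (n.natAbs + 1) := by gcongr
          _ = _ := by ring) n
    have s2 := ih b (Δ_[1] c) B (C * ε) hb
      (fun j n => by rw [← Function.iterate_succ_apply]; refine (hc (j + 1) _).trans_eq ?_; ring) n
    rw [Function.iterate_succ_apply, hD, fwdDiff_iter_add]
    refine (norm_add_le _ _).trans ((add_le_add s1 s2).trans_eq ?_)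
    ring

/-- Products of zero type sequences are of zero type. -/
theorem mul {b c : ℤ → ℂ} (hb : IsZeroType b) (hc : IsZeroType c) :
    IsZeroType fun n => b n * c n := by
  intro ε hε
  set η := min 1 (ε / 3) with hη
  have hη0 : 0 < η := lt_min one_pos (by positivity)
  have hηε : η * (2 + η) ≤ ε := by
    have h1 : η ≤ 1 := min_le_left _ _
    have h2 : η ≤ ε / 3 := min_le_right _ _
    nlinarith
  obtain ⟨B, hB⟩ := hb η hη0
  obtain ⟨C, hC⟩ := hc η hη0
  have hB0 : 0 ≤ B := by simpa using (norm_nonneg _).trans (hB 0 0)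
  have hC0 : 0 ≤ C := by simpa using (norm_nonneg _).trans (hC 0 0)
  refine ⟨B * C, fun k n => (norm_fwdDiff_iter_mul_le hη0.le k b c B C hB hC n).trans ?_⟩
  gcongr

theorem norm_fwdDiff_iter_comp_neg (c : ℤ → ℂ) (k : ℕ) (n : ℤ) :
    ‖(Δ_[1])^[k] (fun m => c (-m)) n‖ = ‖(Δ_[1])^[k] c (-n - k)‖ := by
  induction k generalizing c with
  | zero => simp
  | succ k ih =>
    have hD : Δ_[1] (fun m => c (-m)) = (-1 : ℤ) • fun m => (fun l => Δ_[1] c (l + (-1))) (-m) := by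
      funext m
      simp only [fwdDiff, Pi.smul_apply, neg_smul, one_smul, neg_sub]
      rw [show -(m + 1) = -m + -1 by ring, neg_add_cancel_right]
    rw [Function.iterate_succ_apply, hD, fwdDiff_iter_const_smul, Pi.smul_apply, neg_smul,
      one_smul, norm_neg, ih fun l => Δ_[1] c (l + (-1)), fwdDiff_iter_comp_add,
      ← Function.iterate_succ_apply]
    rw [Nat.succ_eq_add_one, Nat.cast_add_one, show -n - (k : ℤ) + -1 = -n - (k + 1) by ring]

/-- The reflection `n ↦ -n` preserves zero type sequences. -/
theorem comp_neg {c : ℤ → ℂ} (hc : IsZeroType c) : IsZeroType fun n => c (-n) := by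
  intro ε hε
  set η := min 1 (ε / 2) with hη
  have hη0 : 0 < η := lt_min one_pos (by positivity)
  have h1 : η ≤ 1 := min_le_left _ _
  have h2 : η ≤ ε / 2 := min_le_right _ _
  obtain ⟨C, hC⟩ := hc η hη0
  have hC0 : 0 ≤ C := by simpa using (norm_nonneg _).trans (hC 0 0)
  refine ⟨C, fun k n => ?_⟩
  rw [norm_fwdDiff_iter_comp_neg]
  refine (hC k _).trans ?_
  have h3 : (1 + η) ^ (-n - k : ℤ).natAbs ≤ (1 + η) ^ (k + n.natAbs) :=
    pow_le_pow_right₀ (by linarith) (by omega)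
  calc C * η ^ k * (1 + η) ^ (-n - k : ℤ).natAbs
      ≤ C * η ^ k * (1 + η) ^ (k + n.natAbs) := by gcongr
    _ = C * (η * (1 + η)) ^ k * (1 + η) ^ n.natAbs := by rw [pow_add, mul_pow]; ring
    _ ≤ C * ε ^ k * (1 + ε) ^ n.natAbs := by
      have : η * (1 + η) ≤ ε := by nlinarith
      have : η ≤ ε := by linarith
      gcongr

/-- A sequence dominated by its successor contracted by `q`, up to summable errors, and growing
slower than `q ^ (-n)`, starts below the total error. -/
theorem le_of_recursion_le {x α : ℕ → ℝ} {q ρ K A : ℝ} (hq : 0 ≤ q) (hq1 : q ≤ 1)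
    (hρ : 0 ≤ ρ) (hρq : q * ρ < 1) (hα : ∀ n, 0 ≤ α n)
    (hx : ∀ n, x n ≤ α n + q * x (n + 1)) (hxK : ∀ n, x n ≤ K * ρ ^ n)
    (hA : ∀ n, ∑ i ∈ Finset.range n, α i ≤ A) : x 0 ≤ A := by
  have key : ∀ n, x 0 ≤ ∑ i ∈ Finset.range n, α i + q ^ n * x n := by
    intro n
    induction n with
    | zero => simp
    | succ n ih =>
      rw [Finset.sum_range_succ]
      have h1 : q ^ n * x n ≤ q ^ n * (α n + q * x (n + 1)) :=
        mul_le_mul_of_nonneg_left (hx n) (by positivity)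
      have h2 : q ^ n * α n ≤ α n := mul_le_of_le_one_left (hα n) (pow_le_one₀ hq hq1)
      rw [pow_succ]
      nlinarith
  have hlim : Filter.Tendsto (fun n : ℕ => A + K * (q * ρ) ^ n) Filter.atTop (nhds A) := by
    have := (tendsto_pow_atTop_nhds_zero_of_lt_one (mul_nonneg hq hρ) hρq).const_mul K
    simpa using this.const_add A
  refine ge_of_tendsto' hlim fun n => (key n).trans ?_
  have h3 : q ^ n * x n ≤ q ^ n * (K * ρ ^ n) :=
    mul_le_mul_of_nonneg_left (hxK n) (by positivity)
  have := hA n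
  rw [mul_pow]
  nlinarith

/-! ### Newton series and Liouville's theorem -/

/-- The Newton series `∑ wᵏ (Δᵏ a) n` attached to a sequence. When `a` is of zero type it is entire
in `w`, and `(1 + w) * newtonSeries a n w` continues `∑ₘ a (n + m) ζᵐ`, where `ζ = w / (1 + w)`. -/
noncomputable def newtonSeries (a : ℤ → ℂ) (n : ℤ) (w : ℂ) : ℂ :=
  ∑' k : ℕ, w ^ k * (Δ_[1])^[k] a n

variable {a : ℤ → ℂ}

theorem summable_newtonSeries (ha : IsZeroType a) (n : ℤ) (w : ℂ) :
    Summable fun k : ℕ => w ^ k * (Δ_[1])^[k] a n := by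
  obtain ⟨C, hC⟩ := ha (1 / (2 * (‖w‖ + 1))) (by positivity)
  set ε := 1 / (2 * (‖w‖ + 1)) with hε
  have hw : ‖w‖ * ε ≤ 1 / 2 := by
    rw [hε, mul_one_div, div_le_div_iff₀ (by positivity) two_pos]; linarith
  refine Summable.of_norm_bounded
    (g := fun k => C * (1 + ε) ^ n.natAbs * (‖w‖ * ε) ^ k) ?_ fun k => ?_
  · exact (summable_geometric_of_lt_one (by positivity) (by linarith)).mul_left _
  · rw [norm_mul, norm_pow]
    refine (mul_le_mul_of_nonneg_left (hC k n) (by positivity)).trans_eq ?_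
    rw [mul_pow]; ring

/-- The Newton series grows slower than any exponential in its base point. -/
theorem norm_newtonSeries_le (ha : IsZeroType a) (w : ℂ) {δ : ℝ} (hδ : 0 < δ) :
    ∃ K, ∀ n : ℤ, ‖newtonSeries a n w‖ ≤ K * (1 + δ) ^ n.natAbs := by
  set ε := min δ (1 / (2 * (‖w‖ + 1))) with hε
  have hε0 : 0 < ε := lt_min hδ (by positivity)
  have hεδ : ε ≤ δ := min_le_left _ _
  have hw : ‖w‖ * ε ≤ 1 / 2 := by
    have h : ε ≤ 1 / (2 * (‖w‖ + 1)) := min_le_right _ _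
    refine (mul_le_mul_of_nonneg_left h (norm_nonneg w)).trans ?_
    rw [mul_one_div, div_le_div_iff₀ (by positivity) two_pos]; linarith
  obtain ⟨C, hC⟩ := ha ε hε0
  have hC0 : 0 ≤ C := by simpa using (norm_nonneg _).trans (hC 0 0)
  refine ⟨2 * C, fun n => ?_⟩
  have hg := (hasSum_geometric_of_lt_one (r := 1 / 2) (by norm_num) (by norm_num)).mul_left
    (C * (1 + δ) ^ n.natAbs)
  refine (tsum_of_norm_bounded hg fun k => ?_).trans_eq (by norm_num; ring)
  rw [norm_mul, norm_pow]
  calc _ ≤ ‖w‖ ^ k * (C * ε ^ k * (1 + ε) ^ n.natAbs) := by gcongr; exact hC k n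
    _ = C * (1 + ε) ^ n.natAbs * (‖w‖ * ε) ^ k := by rw [mul_pow]; ring
    _ ≤ _ := by gcongr

theorem differentiable_newtonSeries (ha : IsZeroType a) (n : ℤ) :
    Differentiable ℂ (newtonSeries a n) := by
  intro w
  have h : DifferentiableOn ℂ (newtonSeries a n) (Metric.ball 0 (‖w‖ + 1)) := by
    have hs := (ha.summable_newtonSeries n ((‖w‖ + 1 : ℝ) : ℂ)).norm
    refine Complex.differentiableOn_tsum_of_summable_norm hs (fun k => by fun_prop)
      Metric.isOpen_ball fun k v hv => ?_
    rw [mem_ball_zero_iff] at hv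
    rw [norm_mul, norm_mul, norm_pow, norm_pow, Complex.norm_real,
      Real.norm_of_nonneg (by positivity)]
    gcongr
  exact h.differentiableAt (Metric.isOpen_ball.mem_nhds (by simp))

theorem one_add_mul_newtonSeries (ha : IsZeroType a) (n : ℤ) (w : ℂ) :
    (1 + w) * newtonSeries a n w = a n + w * newtonSeries a (n + 1) w := by
  have h0 := ha.summable_newtonSeries n w
  have h1 := ha.summable_newtonSeries (n + 1) w
  have e : newtonSeries a n w = a n + w * (newtonSeries a (n + 1) w - newtonSeries a n w) := by
    rw [newtonSeries, newtonSeries, ← h1.tsum_sub h0, h0.tsum_eq_zero_add, ← tsum_mul_left]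
    simp only [pow_zero, Function.iterate_zero, id_eq, one_mul, add_right_inj]
    refine tsum_congr fun k => ?_
    rw [Function.iterate_succ_apply', fwdDiff]
    ring
  linear_combination e

theorem newtonSeries_zero (n : ℤ) : newtonSeries a n 0 = a n := by
  rw [newtonSeries, tsum_eq_single 0 fun k hk => by simp [hk]]
  simp

theorem exists_pos_mul_one_add_lt_one {q : ℝ} (hq : q < 1) :
    ∃ δ > 0, q * (1 + δ) < 1 :=
  ⟨(1 - q) / 2, by linarith, by nlinarith⟩

/-- For a summable zero type sequence, both expansions of `(1 + w) * newtonSeries a 0 w`, in powers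
of `w / (1 + w)` and of its inverse, converge absolutely, with the same bound. -/
theorem norm_one_add_mul_newtonSeries_le (ha : IsZeroType a) (hs : Summable fun n => ‖a n‖)
    (w : ℂ) : ‖(1 + w) * newtonSeries a 0 w‖ ≤ ∑' n, ‖a n‖ := by
  -- off the line `‖w‖ = ‖1 + w‖` one of the two expansions applies; the line follows by density
  have main : ∀ w : ℂ, w.re ≠ -1 / 2 → ‖(1 + w) * newtonSeries a 0 w‖ ≤ ∑' n, ‖a n‖ := by
    intro w hw
    have hrec := fun n => ha.one_add_mul_newtonSeries n w
    have hsq : ‖1 + w‖ ^ 2 - ‖w‖ ^ 2 = 1 + 2 * w.re := by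
      rw [Complex.sq_norm, Complex.sq_norm, Complex.normSq_apply, Complex.normSq_apply]
      simp; ring
    have hinj : ∀ (g : ℕ → ℤ), Function.Injective g → ∀ N,
        ∑ i ∈ Finset.range N, ‖a (g i)‖ ≤ ∑' n, ‖a n‖ := fun g hg N => by
      rw [← Finset.sum_image (f := fun n => ‖a n‖) (g := g) fun i _ j _ h => hg h]
      exact hs.sum_le_tsum _ fun _ _ => norm_nonneg _
    rcases lt_or_gt_of_ne hw with h | h
    · have hlt : ‖1 + w‖ < ‖w‖ := by
        refine lt_of_pow_lt_pow_left₀ 2 (norm_nonneg _) ?_; linarith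
      have hw0 : 0 < ‖w‖ := (norm_nonneg _).trans_lt hlt
      set q := ‖1 + w‖ / ‖w‖ with hq
      have hq0 : 0 ≤ q := by positivity
      have hq1 : q < 1 := (div_lt_one hw0).2 hlt
      obtain ⟨δ, hδ, hqδ⟩ := exists_pos_mul_one_add_lt_one hq1
      obtain ⟨K, hK⟩ := ha.norm_newtonSeries_le w hδ
      have := le_of_recursion_le (x := fun n : ℕ => ‖(1 + w) * newtonSeries a (-n) w‖)
        (α := fun n => ‖a (-n - 1)‖) (K := ‖1 + w‖ * K) hq0 hq1.le (by linarith : 0 ≤ 1 + δ)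
        hqδ (fun n => norm_nonneg _) (fun n => ?_) (fun n => ?_)
        (hinj (fun n => -n - 1) fun i j h => by simpa using h)
      · simpa using this
      · have e := hrec (-n - 1)
        rw [show (-n - 1 + 1 : ℤ) = -n by ring] at e
        have e2 : ‖w‖ * ‖newtonSeries a (-n) w‖ ≤
            ‖1 + w‖ * ‖newtonSeries a (-n - 1) w‖ + ‖a (-n - 1)‖ := by
          rw [← norm_mul, ← norm_mul, show w * newtonSeries a (-n) w =
            (1 + w) * newtonSeries a (-n - 1) w - a (-n - 1) by rw [e]; ring]
          exact norm_sub_le _ _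
        have e3 : ‖1 + w‖ * ‖newtonSeries a (-n) w‖ = q * (‖w‖ * ‖newtonSeries a (-n) w‖) := by
          rw [hq]; field_simp
        have e4 := mul_le_mul_of_nonneg_left e2 hq0
        have e5 : q * ‖a (-n - 1)‖ ≤ ‖a (-n - 1)‖ :=
          mul_le_of_le_one_left (norm_nonneg _) hq1.le
        push_cast
        rw [show -((n : ℤ) + 1) = -n - 1 by ring, norm_mul, norm_mul, e3]
        linarith
      · rw [norm_mul, mul_assoc]
        have := hK (-n)
        simp only [Int.natAbs_neg, Int.natAbs_natCast] at this
        gcongr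
    · have hlt : ‖w‖ < ‖1 + w‖ := by
        refine lt_of_pow_lt_pow_left₀ 2 (norm_nonneg _) ?_; linarith
      have hw0 : 0 < ‖1 + w‖ := (norm_nonneg _).trans_lt hlt
      set q := ‖w‖ / ‖1 + w‖ with hq
      have hq0 : 0 ≤ q := by positivity
      have hq1 : q < 1 := (div_lt_one hw0).2 hlt
      obtain ⟨δ, hδ, hqδ⟩ := exists_pos_mul_one_add_lt_one hq1
      obtain ⟨K, hK⟩ := ha.norm_newtonSeries_le w hδ
      have := le_of_recursion_le (x := fun n : ℕ => ‖(1 + w) * newtonSeries a n w‖)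
        (α := fun n => ‖a n‖) (K := ‖1 + w‖ * K) hq0 hq1.le (by linarith : 0 ≤ 1 + δ)
        hqδ (fun n => norm_nonneg _) (fun n => ?_) (fun n => ?_)
        (hinj (fun n => n) fun i j h => by simpa using h)
      · simpa using this
      · rw [hrec]
        refine (norm_add_le _ _).trans (add_le_add le_rfl (le_of_eq ?_))
        rw [norm_mul, norm_mul, hq]
        push_cast
        field_simp
      · rw [norm_mul, mul_assoc]
        have := hK n
        simp only [Int.natAbs_natCast] at this
        gcongr
  have hdense : Dense {w : ℂ | w.re ≠ -1 / 2} :=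
    (dense_compl_singleton (-1 / 2 : ℝ)).preimage Complex.isOpenMap_re
  have hclosed : IsClosed {w : ℂ | ‖(1 + w) * newtonSeries a 0 w‖ ≤ ∑' n, ‖a n‖} := by
    have := (ha.differentiable_newtonSeries 0).continuous
    exact isClosed_le (by fun_prop) continuous_const
  exact hclosed.closure_subset_iff.2 main (hdense w)

/-- A summable sequence of zero type vanishes at the origin: by Liouville's theorem the entire
function `(1 + w) * newtonSeries a 0 w` is constant, and it vanishes at `w = -1`. -/
theorem apply_zero_eq_zero (ha : IsZeroType a) (hs : Summable fun n => ‖a n‖) : a 0 = 0 := by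
  have hd : Differentiable ℂ fun w => (1 + w) * newtonSeries a 0 w :=
    (differentiable_id.const_add 1).mul (ha.differentiable_newtonSeries 0)
  have hb : Bornology.IsBounded (Set.range fun w => (1 + w) * newtonSeries a 0 w) := by
    refine (isBounded_iff_forall_norm_le).2 ⟨∑' n, ‖a n‖, ?_⟩
    rintro _ ⟨w, rfl⟩
    exact ha.norm_one_add_mul_newtonSeries_le hs w
  have := hd.apply_eq_apply_of_bounded hb 0 (-1)
  simpa [newtonSeries_zero] using this

end IsZeroType

/-! ### Contour integrals around an isolated singularity -/

section Banach

open Metric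

theorem ContinuousLinearMap.map_circleIntegral {G H : Type*} [NormedAddCommGroup G]
    [NormedSpace ℂ G] [CompleteSpace G] [NormedAddCommGroup H] [NormedSpace ℂ H] [CompleteSpace H]
    (L : G →L[ℂ] H) {f : ℂ → G} {c : ℂ} {r : ℝ} (hf : CircleIntegrable f c r) :
    L (∮ z in C(c, r), f z) = ∮ z in C(c, r), L (f z) := by
  simp only [circleIntegral]
  rw [← L.intervalIntegral_comp_comm hf.out]
  simp

theorem circleIntegral.integral_eq_of_differentiableOn_punctured {G : Type*} [NormedAddCommGroup G]
    [NormedSpace ℂ G] {f : ℂ → G} {c : ℂ} {δ r R : ℝ}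
    (hf : DifferentiableOn ℂ f (ball c δ \ {c})) (hr : 0 < r) (hrδ : r < δ) (hR : 0 < R)
    (hRδ : R < δ) : (∮ z in C(c, r), f z) = ∮ z in C(c, R), f z := by
  wlog h : r ≤ R generalizing r R
  · exact (this hR hRδ hr hrδ (le_of_not_ge h)).symm
  have hopen : IsOpen (ball c δ \ {c}) := isOpen_ball.sdiff isClosed_singleton
  refine (Complex.circleIntegral_eq_of_differentiable_on_annulus_off_countable hr h
    Set.countable_empty (hf.continuousOn.mono ?_) ?_).symm
  · rintro z ⟨hz, hz'⟩
    refine ⟨closedBall_subset_ball hRδ hz, ?_⟩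
    rintro rfl
    exact hz' (mem_ball_self hr)
  · rintro z ⟨⟨hz, hz'⟩, -⟩
    refine hf.differentiableAt (hopen.mem_nhds ⟨ball_subset_ball hRδ.le hz, ?_⟩)
    rintro rfl
    exact hz' (mem_closedBall_self hr.le)

theorem sphere_subset_punctured_ball {c : ℂ} {r δ : ℝ} (hr : 0 < r) (hrδ : r < δ) :
    sphere c r ⊆ ball c δ \ {c} := by
  intro z hz
  refine ⟨by rw [mem_ball, mem_sphere.1 hz]; exact hrδ, ?_⟩
  rintro rfl
  rw [mem_sphere, dist_self] at hz
  exact hr.ne hz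

open fwdDiff in
theorem fwdDiff_iter_circleIntegral_zpow {G : Type*} [NormedAddCommGroup G] [NormedSpace ℂ G]
    {F : ℂ → G} {c : ℂ} {r : ℝ} (hr : 0 ≤ r) (hc0 : c ≠ 0) (hF : ContinuousOn F (sphere c r))
    (h0 : ∀ z ∈ sphere c r, z ≠ 0) (k : ℕ) (n : ℤ) :
    (Δ_[1])^[k] (fun m : ℤ => ∮ z in C(c, r), (z / c) ^ m • F z) n =
      ∮ z in C(c, r), (z / c) ^ n • (z / c - 1) ^ k • F z := by
  have hz : ∀ m : ℤ, ContinuousOn (fun z : ℂ => (z / c) ^ m) (sphere c r) := fun m =>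
    ContinuousOn.zpow₀ (by fun_prop) m fun z hz => Or.inl (div_ne_zero (h0 z hz) hc0)
  have hk : ∀ k : ℕ, ContinuousOn (fun z : ℂ => (z / c - 1) ^ k • F z) (sphere c r) := fun k =>
    ContinuousOn.smul (by fun_prop) hF
  induction k generalizing n with
  | zero => simp
  | succ k ih =>
    rw [Function.iterate_succ_apply', fwdDiff, ih, ih, ← circleIntegral.integral_sub]
    · refine circleIntegral.integral_congr hr fun z hzs => ?_
      simp only [smul_smul]
      rw [← sub_smul, zpow_add_one₀ (div_ne_zero (h0 z hzs) hc0)]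
      congr 1
      ring
    · exact ((hz _).smul (hk _)).circleIntegrable hr
    · exact ((hz _).smul (hk _)).circleIntegrable hr

/-- The moments of a holomorphic function around an isolated singularity `c` on the unit circle
form a zero type sequence, since the contour can be shrunk to `c`. -/
theorem isZeroType_circleIntegral {G : Type*} [NormedAddCommGroup G] [NormedSpace ℂ G]
    {F : ℂ → G} {c : ℂ} (hc : ‖c‖ = 1) {δ r : ℝ}
    (hF : DifferentiableOn ℂ F (ball c δ \ {c})) (hr : 0 < r) (hrδ : r < δ) (hδ1 : δ ≤ 1) :
    IsZeroType fun n : ℤ => ∮ z in C(c, r), (z / c) ^ n • F z := by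
  intro ε hε
  have hc0 : c ≠ 0 := norm_ne_zero_iff.1 (by rw [hc]; exact one_ne_zero)
  have hne : ∀ z ∈ ball c δ, z ≠ 0 := by
    rintro z hz rfl
    rw [mem_ball, dist_zero_left, hc] at hz
    linarith
  -- a radius `ρ` with `ρ ≤ ε` and `1 / (1 - ρ) ≤ 1 + ε`
  set ρ := min (r / 2) (ε / (1 + ε)) with hρ
  have hρ0 : 0 < ρ := lt_min (by positivity) (by positivity)
  have hρr : ρ < r := (min_le_left _ _).trans_lt (by linarith)
  have hρε' : ρ * (1 + ε) ≤ ε := by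
    rw [← le_div_iff₀ (by positivity)]; exact min_le_right _ _
  have hρε : ρ ≤ ε := by nlinarith
  have hρδ : ρ < δ := hρr.trans hrδ
  have hsub : sphere c ρ ⊆ ball c δ \ {c} := sphere_subset_punctured_ball hρ0 hρδ
  have hEq : (fun n : ℤ => ∮ z in C(c, r), (z / c) ^ n • F z) =
      fun n : ℤ => ∮ z in C(c, ρ), (z / c) ^ n • F z := by
    funext n
    refine circleIntegral.integral_eq_of_differentiableOn_punctured (δ := δ) ?_ hr hrδ hρ0 hρδ
    refine DifferentiableOn.smul (fun z hz => ?_) hF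
    have : z / c ≠ 0 := div_ne_zero (hne z hz.1) hc0
    exact ((differentiableAt_id.div_const c).zpow (Or.inl this)).differentiableWithinAt
  have hcont : ContinuousOn F (sphere c ρ) := hF.continuousOn.mono hsub
  obtain ⟨B, hB⟩ := (isCompact_sphere c ρ).exists_bound_of_continuousOn hcont
  refine ⟨2 * Real.pi * ρ * B, fun k n => ?_⟩
  rw [hEq, fwdDiff_iter_circleIntegral_zpow hρ0.le hc0 hcont fun z hz => hne z (hsub hz).1]
  have hbound : ∀ z ∈ sphere c ρ,
      ‖(z / c) ^ n • (z / c - 1) ^ k • F z‖ ≤ (1 + ε) ^ n.natAbs * (ε ^ k * B) := by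
    intro z hz
    have hzc : ‖z - c‖ = ρ := by rw [← dist_eq_norm]; exact hz
    have h1 : ‖z / c - 1‖ ≤ ε := by
      rw [div_sub_one hc0, norm_div, hc, hzc, div_one]; exact hρε
    have hz0 : 0 < ‖z‖ := norm_pos_iff.2 (hne z (hsub hz).1)
    have hup : ‖z / c‖ ≤ 1 + ε := by
      rw [norm_div, hc, div_one]
      have := norm_add_le (z - c) c
      rw [sub_add_cancel, hzc, hc] at this
      linarith
    have hlow : ‖z / c‖⁻¹ ≤ 1 + ε := by
      rw [norm_div, hc, div_one]
      have := norm_sub_norm_le c z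
      rw [norm_sub_rev, hzc, hc] at this
      rw [inv_le_comm₀ hz0 (by positivity), inv_le_iff_one_le_mul₀ (by positivity)]
      nlinarith
    rw [norm_smul, norm_smul, norm_zpow, norm_pow]
    have h2 : ‖z / c‖ ^ n ≤ (1 + ε) ^ n.natAbs := by
      rcases Int.natAbs_eq n with h | h
      · rw [h, zpow_natCast, Int.natAbs_natCast]
        gcongr
      · rw [h, zpow_neg, zpow_natCast, Int.natAbs_neg, Int.natAbs_natCast, ← inv_pow]
        gcongr
    have := hB z hz
    gcongr
  refine (circleIntegral.norm_integral_le_of_norm_le_const hρ0.le hbound).trans_eq ?_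
  ring

/-! ### The Riesz integral at an isolated point of the spectrum -/

theorem continuousOn_resolvent {A : Type*} [NormedRing A] [NormedAlgebra ℂ A] [CompleteSpace A]
    {a : A} {s : Set ℂ} (hs : s ⊆ resolventSet ℂ a) :
    ContinuousOn (resolvent a) s := fun _ hz =>
  (spectrum.hasDerivAt_resolvent_const_left (hs hz)).continuousAt.continuousWithinAt

theorem mul_resolvent {A : Type*} [Ring A] [Algebra ℂ A] {a : A} {z : ℂ}
    (hz : z ∈ resolventSet ℂ a) :
    a * resolvent a z = z • resolvent a z - 1 := by
  have h : (algebraMap ℂ A z - a) * resolvent a z = 1 := Ring.mul_inverse_cancel _ hz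
  rw [sub_mul, ← Algebra.smul_def] at h
  rw [← h]; abel

theorem resolvent_mul {A : Type*} [Ring A] [Algebra ℂ A] {a : A} {z : ℂ}
    (hz : z ∈ resolventSet ℂ a) :
    resolvent a z * a = z • resolvent a z - 1 := by
  have h : resolvent a z * (algebraMap ℂ A z - a) = 1 := Ring.inverse_mul_cancel _ hz
  rw [mul_sub, ← Algebra.commutes, ← Algebra.smul_def] at h
  rw [← h]; abel

variable {A : Type*} [NormedRing A] [NormedAlgebra ℂ A] [CompleteSpace A]

/-- A bounded linear operator acting on the resolvent like multiplication by `a`, acts on contour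
integrals of the resolvent by multiplying the integrand by the variable. -/
theorem map_circleIntegral_smul_resolvent {a : A} {L : A →L[ℂ] A} {c : ℂ} {r : ℝ} (hr : 0 ≤ r)
    (hs : sphere c r ⊆ resolventSet ℂ a)
    (hL : ∀ z ∈ sphere c r, L (resolvent a z) = z • resolvent a z - 1)
    {h : ℂ → ℂ} (hh : ContinuousOn h (sphere c r)) :
    L (∮ z in C(c, r), h z • resolvent a z) =
      (∮ z in C(c, r), (z * h z) • resolvent a z) - (∮ z in C(c, r), h z) • (1 : A) := by
  have hR := continuousOn_resolvent hs
  have i1 : CircleIntegrable (fun z => h z • resolvent a z) c r :=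
    (hh.smul hR).circleIntegrable hr
  have i2 : CircleIntegrable (fun z => (z * h z) • resolvent a z) c r :=
    ((continuousOn_id.mul hh).smul hR).circleIntegrable hr
  have i3 : CircleIntegrable (fun z => h z • (1 : A)) c r :=
    (hh.smul continuousOn_const).circleIntegrable hr
  rw [L.map_circleIntegral i1, ← circleIntegral.integral_smul_const,
    ← circleIntegral.integral_sub i2 i3]
  refine circleIntegral.integral_congr hr fun z hz => ?_
  rw [map_smul, hL z hz, smul_sub, smul_smul, mul_comm]

/-- If the Riesz integral of the resolvent around a point `c` vanishes, then `c` is in the resolvent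
set: the integral of `(z - c)⁻¹ • resolvent a z` inverts `c - a` up to the factor `2πi`. -/
theorem mem_resolventSet_of_circleIntegral_resolvent_eq_zero {a : A} {c : ℂ} {r : ℝ} (hr : 0 < r)
    (hs : sphere c r ⊆ resolventSet ℂ a) (h0 : (∮ z in C(c, r), resolvent a z) = 0) :
    c ∈ resolventSet ℂ a := by
  set Q := ∮ z in C(c, r), (z - c)⁻¹ • resolvent a z with hQ
  have hne : ∀ z ∈ sphere c r, z - c ≠ 0 := by
    intro z hz h
    rw [mem_sphere, dist_eq_norm, h, norm_zero] at hz
    exact hr.ne hz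
  have hcont : ContinuousOn (fun z : ℂ => (z - c)⁻¹) (sphere c r) :=
    ContinuousOn.inv₀ (by fun_prop) hne
  have hR := continuousOn_resolvent hs
  have hzQ : (∮ z in C(c, r), (z * (z - c)⁻¹) • resolvent a z) = c • Q := by
    have : (∮ z in C(c, r), (z * (z - c)⁻¹) • resolvent a z) =
        ∮ z in C(c, r), (resolvent a z + c • (z - c)⁻¹ • resolvent a z) := by
      refine circleIntegral.integral_congr hr.le fun z hz => ?_
      rw [smul_smul, show z * (z - c)⁻¹ = 1 + c * (z - c)⁻¹ by
        have := hne z hz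
        field_simp
        ring, add_smul, one_smul]
    have i1 : CircleIntegrable (fun z => c • (z - c)⁻¹ • resolvent a z) c r :=
      ((hcont.smul hR).const_smul c).circleIntegrable hr.le
    rw [this, circleIntegral.integral_add (hR.circleIntegrable hr.le) i1, h0, zero_add,
      circleIntegral.integral_smul]
  have key : ∀ L : A →L[ℂ] A, (∀ z ∈ sphere c r, L (resolvent a z) = z • resolvent a z - 1) →
      c • Q - L Q = (2 * Real.pi * Complex.I : ℂ) • (1 : A) := by
    intro L hL
    rw [hQ, map_circleIntegral_smul_resolvent hr.le hs hL hcont, hzQ,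
      circleIntegral.integral_sub_center_inv c hr.ne']
    abel
  have hpi : (2 * Real.pi * Complex.I : ℂ) ≠ 0 := Complex.two_pi_I_ne_zero
  have h1 := key (ContinuousLinearMap.mul ℂ A a) fun z hz => mul_resolvent (hs hz)
  have h2 := key ((ContinuousLinearMap.mul ℂ A).flip a) fun z hz => resolvent_mul (hs hz)
  simp only [ContinuousLinearMap.mul_apply', ContinuousLinearMap.flip_apply] at h1 h2
  rw [spectrum.mem_resolventSet_iff]
  refine ⟨⟨algebraMap ℂ A c - a, (2 * Real.pi * Complex.I : ℂ)⁻¹ • Q, ?_, ?_⟩, rfl⟩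
  · rw [mul_smul_comm, sub_mul, ← Algebra.smul_def, h1, inv_smul_smul₀ hpi]
  · rw [smul_mul_assoc, mul_sub, ← Algebra.commutes, ← Algebra.smul_def, h2, inv_smul_smul₀ hpi]

/-- **No isolated points.** Let `T` shift a bilateral sequence `e` of vectors that separates
operators, and suppose that every functional is square summable along `e` against `1 / w`, for
a weight with `w n * w (-n-1) = 1`. Then no point of the unit circle is isolated in the spectrum
of `T`.

For a functional `φ`, the sequence `b n = φ (P (e n))`, `P` being the Riesz integral at the point,
is a zero type sequence up to a rotation, and `b n * b (-n)` is summable by the symmetry of `w`;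
hence `b 0 = 0`. -/
theorem mem_resolventSet_of_isolated {E : Type*} [NormedAddCommGroup E] [NormedSpace ℂ E]
    [CompleteSpace E] {T : E →L[ℂ] E} {e : ℤ → E} (hTe : ∀ n, T (e n) = e (n + 1))
    {w : ℤ → ℝ} (hw : ∀ n, 0 < w n) (hw' : ∀ n, w n * w (-n - 1) = 1)
    (hsum : ∀ φ : E →L[ℂ] ℂ, Summable fun n => ‖φ (e n)‖ ^ 2 / w n)
    (hsep : ∀ X : E →L[ℂ] E, (∀ n, X (e n) = 0) → X = 0)
    {c : ℂ} (hc : ‖c‖ = 1) {δ : ℝ} (hδ : 0 < δ) (hres : ball c δ \ {c} ⊆ resolventSet ℂ T) :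
    c ∈ resolventSet ℂ T := by
  wlog hδ1 : δ ≤ 1 generalizing δ
  · exact this one_pos ((Set.sdiff_subset_sdiff_left
      (ball_subset_ball (le_of_not_ge hδ1))).trans hres) le_rfl
  have hc0 : c ≠ 0 := norm_ne_zero_iff.1 (by rw [hc]; exact one_ne_zero)
  have hne : ∀ z ∈ ball c δ, z ≠ 0 := by
    rintro z hz rfl
    rw [mem_ball, dist_zero_left, hc] at hz
    linarith
  set r := δ / 2 with hr
  have hr0 : 0 < r := by positivity
  have hrδ : r < δ := by rw [hr]; linarith
  have hsub : sphere c r ⊆ ball c δ \ {c} := sphere_subset_punctured_ball hr0 hrδ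
  have hs := hsub.trans hres
  have hR := continuousOn_resolvent hs
  have hzpow : ∀ m : ℤ, DifferentiableOn ℂ (fun z : ℂ => z ^ m) (ball c δ) := fun m z hz =>
    (differentiableAt_zpow.2 (Or.inl (hne z hz))).differentiableWithinAt
  set X : ℤ → E →L[ℂ] E := fun m => ∮ z in C(c, r), z ^ m • resolvent T z with hX
  have hX1 : ∀ m n, X m (e (n + 1)) = X (m + 1) (e n) := by
    intro m n
    have h := map_circleIntegral_smul_resolvent
      (L := (ContinuousLinearMap.mul ℂ (E →L[ℂ] E)).flip T) hr0.le hs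
      (fun z hz => resolvent_mul (hs hz))
      ((hzpow m).continuousOn.mono fun z hz => (hsub hz).1)
    have hzero : (∮ z in C(c, r), z ^ m) = 0 :=
      Complex.circleIntegral_eq_zero_of_differentiable_on_off_countable hr0.le
        Set.countable_empty ((hzpow m).continuousOn.mono (closedBall_subset_ball hrδ))
        fun z hz => (hzpow m).differentiableAt (isOpen_ball.mem_nhds
          (ball_subset_ball hrδ.le hz.1))
    rw [hzero, zero_smul, sub_zero] at h
    have h2 : X m * T = X (m + 1) := by
      refine Eq.trans h (circleIntegral.integral_congr hr0.le fun z hz => ?_)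
      change (z * z ^ m) • resolvent T z = z ^ (m + 1) • resolvent T z
      rw [zpow_add_one₀ (hne z (hsub hz).1), mul_comm]
    rw [← h2, ← hTe]
    rfl
  have hX2 : ∀ m n k, X m (e (n + k)) = X (m + k) (e n) := by
    intro m n k
    induction k using Int.induction_on generalizing m n with
    | zero => simp
    | succ k ih => rw [← add_assoc, hX1, ih]; congr 2; ring
    | pred k ih =>
      have := hX1 (m - 1) (n + (-k - 1))
      rw [show m - 1 + 1 = m by ring] at this
      rw [← this, show n + (-(k : ℤ) - 1) + 1 = n + -k by ring, ih]
      congr 2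
      ring
  have hvanish : ∀ j, X j (e 0) = 0 := by
    intro j
    refine SeparatingDual.eq_zero_of_forall_dual_eq_zero (R := ℂ) fun φ => ?_
    set b : ℤ → ℂ := fun n => φ (X j (e n)) with hb
    set F : ℂ → ℂ := fun z => z ^ j • φ (resolvent T z (e 0)) with hF
    set Φ : (E →L[ℂ] E) →L[ℂ] ℂ := φ.comp (ContinuousLinearMap.apply ℂ E (e 0)) with hΦ
    have hFd : DifferentiableOn ℂ F (ball c δ \ {c}) := by
      refine ((hzpow j).mono Set.sdiff_subset).smul fun z hz => ?_
      exact (Φ.differentiableAt.comp z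
        (spectrum.hasDerivAt_resolvent_const_left (hres hz)).differentiableAt).differentiableWithinAt
    set d : ℤ → ℂ := fun n => ∮ z in C(c, r), (z / c) ^ n • F z with hd
    have hzt : IsZeroType d := isZeroType_circleIntegral hc hFd hr0 hrδ hδ1
    have hbd : ∀ n, d n = (c ^ n)⁻¹ * b n := by
      intro n
      have h1 : b n = Φ (X (j + n)) := by
        have := hX2 j 0 n
        rw [zero_add] at this
        simp only [hb, this]
        rfl
      have hint : CircleIntegrable (fun z => z ^ (j + n) • resolvent T z) c r :=
        ContinuousOn.circleIntegrable hr0.le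
          (((hzpow (j + n)).continuousOn.mono fun z hz => (hsub hz).1).smul hR)
      rw [h1, hX, Φ.map_circleIntegral hint, ← smul_eq_mul, ← circleIntegral.integral_smul, hd]
      refine circleIntegral.integral_congr hr0.le fun z hz => ?_
      simp only [hF, map_smul, smul_smul, div_zpow]
      rw [zpow_add₀ (hne z (hsub hz).1)]
      simp only [hΦ, ContinuousLinearMap.comp_apply, ContinuousLinearMap.apply_apply, smul_eq_mul]
      ring
    have hdd : ∀ n, d n * d (-n) = b n * b (-n) := by
      intro n
      have := zpow_ne_zero n hc0
      rw [hbd, hbd, zpow_neg, inv_inv]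
      field_simp
    have hprod := hzt.mul hzt.comp_neg
    simp only [hdd] at hprod
    have hs1 := hsum (φ.comp (X j))
    have hs2 := (hsum (φ.comp (X (j + 1)))).comp_injective
      (i := fun n : ℤ => -n - 1) fun m n h => by simpa using h
    have hsm : Summable fun n => ‖b n * b (-n)‖ := by
      refine Summable.of_nonneg_of_le (fun _ => norm_nonneg _) (fun n => ?_) (hs1.add hs2)
      have e2 : X (j + 1) (e (-n - 1)) = X j (e (-n)) := by
        rw [← hX1, sub_add_cancel]
      simp only [Function.comp_apply, ContinuousLinearMap.comp_apply, e2, norm_mul]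
      change ‖b n‖ * ‖b (-n)‖ ≤ ‖b n‖ ^ 2 / w n + ‖b (-n)‖ ^ 2 / w (-n - 1)
      have hp := hw n
      have e3 : w (-n - 1) = (w n)⁻¹ := eq_inv_of_mul_eq_one_right (hw' n)
      have e4 : ‖b n‖ ^ 2 / w n + ‖b (-n)‖ ^ 2 / w (-n - 1) =
          (‖b n‖ ^ 2 + (‖b (-n)‖ * w n) ^ 2) / w n := by
        rw [e3]; field_simp
      rw [e4, le_div_iff₀ hp]
      nlinarith [sq_nonneg (‖b n‖ - ‖b (-n)‖ * w n), mul_nonneg (mul_nonneg (norm_nonneg (b n))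
        (norm_nonneg (b (-n)))) hp.le]
    have h00 := hprod.apply_zero_eq_zero hsm
    simpa [hb] using h00
  refine mem_resolventSet_of_circleIntegral_resolvent_eq_zero hr0 hs ?_
  have hX0 : X 0 = ∮ z in C(c, r), resolvent T z := by simp [hX]
  rw [← hX0]
  refine hsep _ fun n => ?_
  have := hX2 0 0 n
  rwa [zero_add, hvanish n] at this

end Banach

/-! ### Consequences for the spectrum -/

section Spectrum

variable {E : Type*} [NormedAddCommGroup E] [NormedSpace ℂ E] [CompleteSpace E]

/-- An operator whose powers grow slower than every exponential has its spectrum in the closed unit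
disk. -/
theorem norm_le_one_of_mem_spectrum {T : E →L[ℂ] E}
    (hT : ∀ ρ > 1, ∃ C : ℝ, ∀ (m : ℕ) (x : E), ‖T^[m] x‖ ≤ √(C * ρ ^ m) * ‖x‖)
    {μ : ℂ} (hμ : μ ∈ spectrum ℂ T) : ‖μ‖ ≤ 1 := by
  by_contra! h
  obtain ⟨C, hC⟩ := hT ‖μ‖ h
  have hpow : ∀ m : ℕ, ‖μ‖ ^ m ≤ C := by
    intro m
    have h1 : ‖μ ^ m‖ ≤ ‖T ^ m‖ * ‖(1 : E →L[ℂ] E)‖ :=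
      spectrum.norm_le_norm_mul_of_mem (spectrum.pow_mem_pow T m hμ)
    have h2 : ‖T ^ m‖ ≤ √(C * ‖μ‖ ^ m) :=
      (T ^ m).opNorm_le_bound (Real.sqrt_nonneg _) fun x => by
        rw [show (T ^ m) x = T^[m] x from congrFun (FunLike.coe_pow_eq_iterate T m) x]
        exact hC m x
    have h3 : ‖μ‖ ^ m ≤ √(C * ‖μ‖ ^ m) := by
      refine (norm_pow μ m).ge.trans (h1.trans ((mul_le_of_le_one_right (norm_nonneg _) ?_).trans h2))
      exact ContinuousLinearMap.norm_id_le
    have hpos : 0 < ‖μ‖ ^ m := by positivity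
    have h4 := (Real.le_sqrt' hpos).1 h3
    rw [sq] at h4
    exact le_of_mul_le_mul_right h4 hpos
  obtain ⟨m, hm⟩ := pow_unbounded_of_one_lt C h
  exact absurd (hpow m) (not_le.2 hm)

theorem spectrum_subset_sphere {T S : E →L[ℂ] E} (hTS : ∀ x, T (S x) = x) (hST : ∀ x, S (T x) = x)
    (hT : ∀ ρ > 1, ∃ C : ℝ, ∀ (m : ℕ) (x : E), ‖T^[m] x‖ ≤ √(C * ρ ^ m) * ‖x‖)
    (hS : ∀ ρ > 1, ∃ C : ℝ, ∀ (m : ℕ) (x : E), ‖S^[m] x‖ ≤ √(C * ρ ^ m) * ‖x‖) :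
    spectrum ℂ T ⊆ Metric.sphere 0 1 := by
  intro μ hμ
  rw [mem_sphere_zero_iff_norm]
  let u : (E →L[ℂ] E)ˣ :=
    ⟨T, S, ContinuousLinearMap.ext hTS, ContinuousLinearMap.ext hST⟩
  have hμ0 : μ ≠ 0 := spectrum.ne_zero_of_mem_of_unit (a := u) hμ
  have hinv : μ⁻¹ ∈ spectrum ℂ S := spectrum.inv_mem_iff (r := Units.mk0 μ hμ0) (a := u) |>.1 hμ
  refine le_antisymm (norm_le_one_of_mem_spectrum hT hμ) ?_
  have := norm_le_one_of_mem_spectrum hS hinv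
  rw [norm_inv] at this
  exact (inv_le_one₀ (norm_pos_iff.2 hμ0)).1 this

theorem perfect_spectrum_of_isolated_mem_resolventSet {T : E →L[ℂ] E}
    (h : ∀ c ∈ spectrum ℂ T, ∀ δ > 0, ¬ Metric.ball c δ \ {c} ⊆ resolventSet ℂ T) :
    Perfect (spectrum ℂ T) := by
  refine ⟨spectrum.isClosed T, preperfect_iff_nhds.2 fun c hc U hU => ?_⟩
  obtain ⟨δ, hδ, hU⟩ := Metric.mem_nhds_iff.1 hU
  obtain ⟨z, hz, hzr⟩ := Set.not_subset.1 (h c hc δ hδ)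
  exact ⟨z, ⟨hU hz.1, hzr⟩, hz.2⟩

theorem subsingleton_of_spectrum_eq_empty {T : E →L[ℂ] E} (h : spectrum ℂ T = ∅) :
    Subsingleton E := by
  by_contra hE
  rw [not_subsingleton_iff_nontrivial] at hE
  exact (spectrum.nonempty T).ne_empty h

end Spectrum

theorem Perfect.eq_empty_of_countable {α : Type*} [MetricSpace α] [CompleteSpace α] {s : Set α}
    (hs : Perfect s) (hc : s.Countable) : s = ∅ := by
  by_contra h
  obtain ⟨f, hf, -, hinj⟩ := hs.exists_nat_bool_injection (Set.nonempty_iff_ne_empty.2 h)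
  have h1 := Set.MapsTo.countable_of_injOn (s := Set.univ) (fun x _ => hf ⟨x, rfl⟩) hinj.injOn hc
  have := Set.countable_univ_iff.1 h1
  -- Cantor's diagonal argument on `ℕ → Bool`
  obtain ⟨g, hg⟩ := exists_surjective_nat (ℕ → Bool)
  obtain ⟨n, hn⟩ := hg fun n => !g n n
  simpa using congrFun hn n

/-! ### Growth and symmetry of the weight sequence -/

namespace RadialWeight

theorem moment_antitone (ω : RadialWeight) : Antitone ω.moment :=
  antitone_nat_of_succ_le ω.moment_succ_le

/-- The ratios of consecutive moments increase, so the moments are supermultiplicative after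
normalization. -/
theorem moment_mul_moment_le (ω : RadialWeight) (n m : ℕ) :
    ω.moment n * ω.moment m ≤ ω.moment 0 * ω.moment (n + m) := by
  have p := ω.moment_pos
  have hratio : Monotone fun k => ω.moment (k + 1) / ω.moment k :=
    monotone_nat_of_le_succ fun k => by
      have := ω.moment_sq_le k
      rw [div_le_div_iff₀ (p _) (p _)]
      nlinarith
  induction m with
  | zero => rw [add_zero, mul_comm]
  | succ m ih =>
    have h := hratio (Nat.le_add_left m n)
    simp only at h
    have e1 : ω.moment (m + 1) = ω.moment m * (ω.moment (m + 1) / ω.moment m) := by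
      have := (p m).ne'
      field_simp
    have e2 : ω.moment (n + m + 1) =
        ω.moment (n + m) * (ω.moment (n + m + 1) / ω.moment (n + m)) := by
      have := (p (n + m)).ne'
      field_simp
    rw [← add_assoc, e2, e1, ← mul_assoc, ← mul_assoc]
    have h0 := p 0
    have h1 := p (n + m)
    have h2 : 0 ≤ ω.moment (m + 1) / ω.moment m := (div_pos (p _) (p _)).le
    exact mul_le_mul ih h h2 (mul_pos h0 h1).le

/-- The moments decay slower than every exponential, because the weight is positive near the unit
circle. -/
theorem exists_mul_pow_le_moment (ω : RadialWeight) {s : ℝ} (hs0 : 0 < s) (hs : s < 1) :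
    ∃ c > 0, ∀ m, c * s ^ m ≤ ω.moment m := by
  have hball := Metric.isOpen_ball (x := (0 : ℂ)) (ε := 1)
  set U : Set ℂ := Metric.ball 0 1 \ Metric.closedBall 0 (√s) with hU
  have hUopen : IsOpen U := hball.sdiff Metric.isClosed_closedBall
  have hUsub : U ⊆ Metric.ball 0 1 := Set.sdiff_subset
  have hint : MeasureTheory.IntegrableOn ω.toFun U := ω.integrableOn.mono_set hUsub
  have hpos : 0 < ∫ z in U, ω.toFun z := by
    rw [MeasureTheory.setIntegral_pos_iff_support_of_nonneg_ae _ hint]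
    · have hsub : U ⊆ Function.support ω.toFun ∩ U := fun z hz =>
        ⟨(ω.pos z (hUsub hz)).ne', hz⟩
      refine lt_of_lt_of_le (hUopen.measure_pos _ ?_) (MeasureTheory.measure_mono hsub)
      have hs1 : √s < 1 := (Real.sqrt_lt' one_pos).2 (by simpa using hs)
      obtain ⟨t, ht1, ht2⟩ := exists_between hs1
      have ht0 : 0 ≤ t := (Real.sqrt_nonneg s).trans ht1.le
      refine ⟨(t : ℂ), ?_, ?_⟩
      · simpa [abs_of_nonneg ht0] using ht2
      · simpa [abs_of_nonneg ht0] using ht1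
    · filter_upwards [MeasureTheory.ae_restrict_mem hUopen.measurableSet] with z hz
      exact (ω.pos z (hUsub hz)).le
  refine ⟨Real.pi⁻¹ * ∫ z in U, ω.toFun z, mul_pos (inv_pos.2 Real.pi_pos) hpos, fun m => ?_⟩
  have hm := ω.integrableOn_poly_mul (g := fun z => ‖z‖ ^ (2 * m)) (by fun_prop)
  rw [moment, mul_assoc]
  refine mul_le_mul_of_nonneg_left ?_ (inv_pos.2 Real.pi_pos).le
  calc (∫ z in U, ω.toFun z) * s ^ m = ∫ z in U, s ^ m * ω.toFun z := by
        rw [MeasureTheory.integral_const_mul, mul_comm]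
    _ ≤ ∫ z in U, ‖z‖ ^ (2 * m) * ω.toFun z := by
        refine MeasureTheory.setIntegral_mono_on (hint.const_mul _) (hm.mono_set hUsub)
          hUopen.measurableSet fun z hz => ?_
        refine mul_le_mul_of_nonneg_right ?_ (ω.pos z (hUsub hz)).le
        rw [pow_mul]
        refine pow_le_pow_left₀ hs0.le ?_ m
        have h : √s < ‖z‖ := by simpa using hz.2
        exact ((Real.sqrt_lt' ((Real.sqrt_nonneg s).trans_lt h)).1 h).le
    _ ≤ ∫ z in Metric.ball (0 : ℂ) 1, ‖z‖ ^ (2 * m) * ω.toFun z := by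
        refine MeasureTheory.setIntegral_mono_set hm ?_ hUsub.eventuallyLE
        filter_upwards [MeasureTheory.ae_restrict_mem hball.measurableSet] with z hz
        exact mul_nonneg (by positivity) (ω.pos z hz).le

theorem Omega_mul_Omega_reflect (ω : RadialWeight) (n : ℤ) :
    ω.Omega n * ω.Omega (-n - 1) = 1 := by
  cases n with
  | ofNat n =>
    rw [show -(Int.ofNat n) - 1 = Int.negSucc n by rw [Int.negSucc_eq]; simp; ring]
    exact mul_one_div_cancel (ω.moment_pos n).ne'
  | negSucc n =>
    rw [show -(Int.negSucc n) - 1 = Int.ofNat n by rw [Int.negSucc_eq]; simp]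
    exact one_div_mul_cancel (ω.moment_pos n).ne'

theorem Omega_natCast (ω : RadialWeight) (n : ℕ) : ω.Omega n = ω.moment n := rfl

theorem Omega_neg_natCast (ω : RadialWeight) (n : ℕ) : ω.Omega (-n - 1) = 1 / ω.moment n := by
  rw [show -(n : ℤ) - 1 = Int.negSucc n by rw [Int.negSucc_eq]; ring]
  rfl

/-- The three positions of the interval `[n, n + m]` relative to the reflection point of `Omega`. -/
theorem exists_cases_add_natCast (n : ℤ) (m : ℕ) :
    (∃ k : ℕ, n = k ∧ n + m = (k + m : ℕ)) ∨
    (∃ k : ℕ, n = -(k + m : ℕ) - 1 ∧ n + m = -k - 1) ∨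
    ∃ j k : ℕ, n = -k - 1 ∧ n + m = j ∧ j + k ≤ m := by
  rcases le_or_gt 0 n with h | h
  · exact Or.inl ⟨n.toNat, by omega, by omega⟩
  · rcases le_or_gt 0 (n + m) with h' | h'
    · exact Or.inr (Or.inr ⟨(n + m).toNat, (-n - 1).toNat, by omega, by omega, by omega⟩)
    · exact Or.inr (Or.inl ⟨(-n - m - 1).toNat, by omega, by omega⟩)

/-- The forward shift is power bounded: the moments decrease, and so do their reflected inverses. -/
theorem exists_Omega_add_le (ω : RadialWeight) :
    ∃ C : ℝ, ∀ (m : ℕ) (n : ℤ), ω.Omega (n + m) ≤ C * ω.Omega n := by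
  have p := ω.moment_pos
  refine ⟨1 + ω.moment 0 ^ 2, fun m n => ?_⟩
  have hC : 1 ≤ 1 + ω.moment 0 ^ 2 := by nlinarith [sq_nonneg (ω.moment 0)]
  rcases exists_cases_add_natCast n m with ⟨k, h1, h2⟩ | ⟨k, h1, h2⟩ | ⟨j, k, h1, h2, -⟩
  · rw [h2, h1, Omega_natCast, Omega_natCast]
    exact (ω.moment_antitone (Nat.le_add_right k m)).trans (le_mul_of_one_le_left (p k).le hC)
  · rw [h2, h1, Omega_neg_natCast, Omega_neg_natCast]
    exact (one_div_le_one_div_of_le (p _) (ω.moment_antitone (Nat.le_add_right k m))).trans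
      (le_mul_of_one_le_left (one_div_pos.2 (p _)).le hC)
  · rw [h2, h1, Omega_natCast, Omega_neg_natCast, mul_one_div, le_div_iff₀ (p k)]
    have hj := ω.moment_antitone (Nat.zero_le j)
    have hk := ω.moment_antitone (Nat.zero_le k)
    have := mul_le_mul hj hk (p k).le (p 0).le
    nlinarith

/-- The powers of the backward shift grow slower than every exponential. -/
theorem exists_Omega_le_mul_pow (ω : RadialWeight) {ρ : ℝ} (hρ : 1 < ρ) :
    ∃ C : ℝ, ∀ (m : ℕ) (n : ℤ), ω.Omega n ≤ C * ρ ^ m * ω.Omega (n + m) := by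
  have p := ω.moment_pos
  have hρ0 : 0 < ρ := one_pos.trans hρ
  obtain ⟨c, hc, h⟩ := ω.exists_mul_pow_le_moment (inv_pos.2 hρ0) (inv_lt_one_of_one_lt₀ hρ)
  have h' : ∀ m, 1 ≤ c⁻¹ * ρ ^ m * ω.moment m := fun m => by
    have := mul_le_mul_of_nonneg_left (h m) (by positivity : 0 ≤ c⁻¹ * ρ ^ m)
    rwa [inv_pow, show c⁻¹ * ρ ^ m * (c * (ρ ^ m)⁻¹) = 1 by field_simp] at this
  set C := ω.moment 0 * c⁻¹ + c⁻¹ * c⁻¹ with hC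
  have hC1 : ω.moment 0 * c⁻¹ ≤ C := by rw [hC]; linarith [show 0 < c⁻¹ * c⁻¹ by positivity]
  have hC2 : c⁻¹ * c⁻¹ ≤ C := by
    rw [hC]; linarith [mul_pos (p 0) (inv_pos.2 hc)]
  have step : ∀ k m, ω.moment k ≤ C * ρ ^ m * ω.moment (k + m) := fun k m => by
    have hk := p (k + m)
    calc ω.moment k ≤ ω.moment k * (c⁻¹ * ρ ^ m * ω.moment m) :=
          le_mul_of_one_le_right (p k).le (h' m)
      _ = c⁻¹ * ρ ^ m * (ω.moment k * ω.moment m) := by ring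
      _ ≤ c⁻¹ * ρ ^ m * (ω.moment 0 * ω.moment (k + m)) :=
          mul_le_mul_of_nonneg_left (ω.moment_mul_moment_le k m) (by positivity)
      _ = ω.moment 0 * c⁻¹ * ρ ^ m * ω.moment (k + m) := by ring
      _ ≤ _ := by gcongr
  refine ⟨C, fun m n => ?_⟩
  rcases exists_cases_add_natCast n m with ⟨k, h1, h2⟩ | ⟨k, h1, h2⟩ | ⟨j, k, h1, h2, hjk⟩
  · rw [h2, h1, Omega_natCast, Omega_natCast]
    exact step k m
  · rw [h2, h1, Omega_neg_natCast, Omega_neg_natCast, mul_one_div,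
      div_le_div_iff₀ (p _) (p _), one_mul]
    exact step k m
  · rw [h2, h1, Omega_natCast, Omega_neg_natCast, div_le_iff₀ (p k)]
    have hj := p j
    have hk := p k
    calc 1 ≤ (c⁻¹ * ρ ^ j * ω.moment j) * (c⁻¹ * ρ ^ k * ω.moment k) :=
          one_le_mul_of_one_le_of_one_le (h' j) (h' k)
      _ = c⁻¹ * c⁻¹ * ρ ^ (j + k) * ω.moment j * ω.moment k := by rw [pow_add]; ring
      _ ≤ C * ρ ^ m * ω.moment j * ω.moment k := by
        have := pow_le_pow_right₀ hρ.le hjk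
        have hC0 : 0 ≤ C := (by positivity : 0 ≤ c⁻¹ * c⁻¹).trans hC2
        gcongr

end RadialWeight

/-! ### The space `𝔏²(𝕋,ω)`: model, monomials, powers of the shift -/

namespace LaurentL2

variable {ω : RadialWeight}

/-- The Hilbert space `𝔏²(𝕋,ω)` is isometric to `ℓ²(ℤ)`, by multiplying the coefficients by the
square roots of the weights. -/
noncomputable def toEllTwo (ω : RadialWeight) : LaurentL2 ω ≃ₗᵢ[ℂ] lp (fun _ : ℤ => ℂ) 2 where
  toFun f := ⟨fun n => (√(ω.Omega n) : ℂ) * f.coeff n, by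
    refine (memℓp_gen_iff (by simp)).2 ?_
    refine f.summable_coeff.congr fun n => ?_
    simp [mul_pow, Real.sq_sqrt (ω.Omega_pos n).le, mul_comm]⟩
  map_add' f g := by
    ext n
    exact mul_add _ (f.coeff n) (g.coeff n)
  map_smul' t f := by
    ext n
    exact mul_left_comm _ t (f.coeff n)
  invFun g := ⟨fun n => (√(ω.Omega n) : ℂ)⁻¹ * g n, by
    have := (memℓp_gen_iff (by simp)).1 (lp.memℓp g)
    refine this.congr fun n => ?_
    have := (ω.Omega_pos n).ne'
    simp [mul_pow, Real.sq_sqrt (ω.Omega_pos n).le]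
    field_simp⟩
  left_inv f := by
    refine ext_coeff fun n => ?_
    have : (√(ω.Omega n) : ℂ) ≠ 0 := by exact_mod_cast (Real.sqrt_pos.2 (ω.Omega_pos n)).ne'
    exact inv_mul_cancel_left₀ this _
  right_inv g := by
    ext n
    have : (√(ω.Omega n) : ℂ) ≠ 0 := by exact_mod_cast (Real.sqrt_pos.2 (ω.Omega_pos n)).ne'
    exact mul_inv_cancel_left₀ this _
  norm_map' f := by
    rw [lp.norm_eq_tsum_rpow (by simp), norm_def, Real.sqrt_eq_rpow]
    refine congrArg₂ (· ^ ·) (tsum_congr fun n => ?_) (by simp)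
    change ‖(√(ω.Omega n) : ℂ) * f.coeff n‖ ^ ENNReal.toReal 2 = _
    simp [mul_pow, Real.sq_sqrt (ω.Omega_pos n).le, mul_comm]

theorem coeff_toEllTwo_symm (g : lp (fun _ : ℤ => ℂ) 2) (n : ℤ) :
    ((toEllTwo ω).symm g).coeff n = (√(ω.Omega n) : ℂ)⁻¹ * g n := rfl

instance : CompleteSpace (LaurentL2 ω) :=
  ((toEllTwo ω).isometry.isUniformInducing.completeSpace_congr (toEllTwo ω).surjective).2
    inferInstance

/-- The Laurent monomial `zⁿ`. -/
noncomputable def monomial (ω : RadialWeight) (n : ℤ) : LaurentL2 ω :=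
  (toEllTwo ω).symm (lp.single 2 n (√(ω.Omega n) : ℂ))

theorem coeff_monomial (n k : ℤ) : (monomial ω n).coeff k = if k = n then 1 else 0 := by
  rw [monomial, coeff_toEllTwo_symm, lp.single_apply, Pi.single_apply]
  split_ifs with h
  · subst h
    exact inv_mul_cancel₀ (by exact_mod_cast (Real.sqrt_pos.2 (ω.Omega_pos k)).ne')
  · exact mul_zero _

theorem shift_monomial (n : ℤ) : shift ω (monomial ω n) = monomial ω (n + 1) :=
  ext_coeff fun k => by
    rw [coeff_shift, coeff_monomial, coeff_monomial]
    simp only [sub_eq_iff_eq_add]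

theorem eq_zero_of_apply_monomial_eq_zero {F : Type*} [NormedAddCommGroup F] [NormedSpace ℂ F]
    {L : LaurentL2 ω →L[ℂ] F} (h : ∀ n, L (monomial ω n) = 0) : L = 0 := by
  ext f
  set M : lp (fun _ : ℤ => ℂ) 2 →L[ℂ] F :=
    L.comp ((toEllTwo ω).symm.toContinuousLinearEquiv : lp (fun _ : ℤ => ℂ) 2 →L[ℂ] LaurentL2 ω)
  have hs : ∀ (n : ℤ) (t : ℂ), M (lp.single 2 n t) = 0 := by
    intro n t
    have h0 : (√(ω.Omega n) : ℂ) ≠ 0 := by exact_mod_cast (Real.sqrt_pos.2 (ω.Omega_pos n)).ne'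
    have : lp.single (E := fun _ : ℤ => ℂ) 2 n t =
        (t * (√(ω.Omega n) : ℂ)⁻¹) • lp.single 2 n (√(ω.Omega n) : ℂ) := by
      rw [← lp.single_smul, smul_eq_mul, inv_mul_cancel_right₀ h0]
    rw [this, map_smul]
    change _ • L (monomial ω n) = 0
    rw [h, smul_zero]
  have hsum := (lp.hasSum_single (by simp) (toEllTwo ω f)).mapL M
  simp only [hs] at hsum
  have := hsum.unique hasSum_zero
  have e : M (toEllTwo ω f) = L f := congrArg L ((toEllTwo ω).symm_apply_apply f)
  rw [e] at this
  exact this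

/-- The values of a bounded functional on the monomials, which are its coefficients in the dual
space, are square summable against `1 / Omega`. -/
theorem summable_apply_monomial (φ : LaurentL2 ω →L[ℂ] ℂ) :
    Summable fun n => ‖φ (monomial ω n)‖ ^ 2 / ω.Omega n := by
  set ψ : lp (fun _ : ℤ => ℂ) 2 →L[ℂ] ℂ :=
    φ.comp ((toEllTwo ω).symm.toContinuousLinearEquiv : lp (fun _ : ℤ => ℂ) 2 →L[ℂ] LaurentL2 ω)
  set y := (InnerProductSpace.toDual ℂ (lp (fun _ : ℤ => ℂ) 2)).symm ψ with hy
  have hφ : ∀ n, φ (monomial ω n) = (√(ω.Omega n) : ℂ) * (starRingEnd ℂ) (y n) := by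
    intro n
    have h1 : φ (monomial ω n) = ψ (lp.single 2 n (√(ω.Omega n) : ℂ)) := rfl
    rw [h1, ← InnerProductSpace.toDual_symm_apply, ← hy, lp.inner_single_right]
    simp
  have hys := (memℓp_gen_iff (by simp)).1 (lp.memℓp y)
  refine hys.congr fun n => ?_
  have := (ω.Omega_pos n).ne'
  rw [hφ]
  simp [mul_pow, Real.sq_sqrt (ω.Omega_pos n).le]
  field_simp

theorem coeff_shift_iterate (m : ℕ) (f : LaurentL2 ω) (n : ℤ) :
    ((shift ω)^[m] f).coeff n = f.coeff (n - m) := by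
  induction m generalizing n with
  | zero => simp
  | succ m ih =>
    rw [Function.iterate_succ_apply', coeff_shift, ih]
    congr 1
    push_cast
    ring

theorem coeff_shift_symm (f : LaurentL2 ω) (n : ℤ) :
    ((shift ω).symm f).coeff n = f.coeff (n - (-1)) := rfl

theorem coeff_shift_symm_iterate (m : ℕ) (f : LaurentL2 ω) (n : ℤ) :
    ((shift ω).symm^[m] f).coeff n = f.coeff (n - (-m)) := by
  induction m generalizing n with
  | zero => simp
  | succ m ih =>
    rw [Function.iterate_succ_apply', coeff_shift_symm, ih]
    congr 1
    push_cast
    ring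

theorem exists_norm_shift_iterate_le (ω : RadialWeight) :
    ∃ C : ℝ, ∀ (m : ℕ) (f : LaurentL2 ω), ‖(shift ω)^[m] f‖ ≤ √C * ‖f‖ := by
  obtain ⟨C, hC⟩ := ω.exists_Omega_add_le
  refine ⟨C, fun m f => ?_⟩
  rw [norm_def]
  simp only [coeff_shift_iterate]
  refine (translate_bound (m : ℤ) (fun n => ?_) f).2
  simpa using hC m (n - m)

theorem exists_norm_shift_symm_iterate_le (ω : RadialWeight) {ρ : ℝ} (hρ : 1 < ρ) :
    ∃ C : ℝ, ∀ (m : ℕ) (f : LaurentL2 ω), ‖(shift ω).symm^[m] f‖ ≤ √(C * ρ ^ m) * ‖f‖ := by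
  obtain ⟨C, hC⟩ := ω.exists_Omega_le_mul_pow hρ
  refine ⟨C, fun m f => ?_⟩
  rw [norm_def]
  simp only [coeff_shift_symm_iterate]
  refine (translate_bound (-m : ℤ) (fun n => ?_) f).2
  simpa using hC m n

/-! ### The operator induced on a quotient -/

variable {N : Submodule ℂ (LaurentL2 ω)}

/-- The inverse of the operator induced by the shift on the quotient by `N`. -/
noncomputable def inducedShiftSymm (N : Submodule ℂ (LaurentL2 ω))
    (hN : IsBilaterallyInvariant N) : (LaurentL2 ω ⧸ N) →L[ℂ] (LaurentL2 ω ⧸ N) :=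
  N.liftQL (N.mkQL.comp ((shift ω).symm : LaurentL2 ω →L[ℂ] LaurentL2 ω)) fun f hf =>
    (Submodule.Quotient.mk_eq_zero N).2 (hN.shift_symm_mem f hf)

theorem inducedShiftSymm_mk (hN : IsBilaterallyInvariant N) (f : LaurentL2 ω) :
    inducedShiftSymm N hN (Submodule.Quotient.mk f) =
      Submodule.Quotient.mk ((shift ω).symm f) := rfl

theorem norm_quotient_iterate_le {T : LaurentL2 ω ⧸ N → LaurentL2 ω ⧸ N}
    {S : LaurentL2 ω → LaurentL2 ω}
    (hT : ∀ f, T (Submodule.Quotient.mk f) = Submodule.Quotient.mk (S f)) {K : ℝ} {m : ℕ}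
    (hK : 0 ≤ K) (hS : ∀ f, ‖S^[m] f‖ ≤ K * ‖f‖) (x : LaurentL2 ω ⧸ N) :
    ‖T^[m] x‖ ≤ K * ‖x‖ := by
  have hiter : ∀ f, T^[m] (Submodule.Quotient.mk f) = Submodule.Quotient.mk (S^[m] f) := fun f =>
    (Function.Semiconj.iterate_right (f := (Submodule.Quotient.mk : _ → LaurentL2 ω ⧸ N))
      (fun f => (hT f).symm) m f).symm
  have hlim : Filter.Tendsto (fun ε : ℝ => K * (‖x‖ + ε)) (nhdsWithin 0 (Set.Ioi 0))
      (nhds (K * ‖x‖)) := by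
    have : Continuous fun ε : ℝ => K * (‖x‖ + ε) := by fun_prop
    simpa using (this.tendsto 0).mono_left nhdsWithin_le_nhds
  refine ge_of_tendsto hlim (Filter.eventually_of_mem self_mem_nhdsWithin fun ε hε => ?_)
  obtain ⟨f, rfl, hf⟩ := Submodule.Quotient.norm_mk_lt x hε
  rw [hiter]
  exact (Submodule.Quotient.norm_mk_le (S := N) _).trans
    ((hS f).trans (mul_le_mul_of_nonneg_left hf.le hK))

theorem spectrum_inducedShift_subset_sphere (hN : IsBilaterallyInvariant N) :
    spectrum ℂ (inducedShift N hN) ⊆ Metric.sphere 0 1 := by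
  have : IsClosed (N : Set (LaurentL2 ω)) := hN.isClosed
  refine spectrum_subset_sphere (S := inducedShiftSymm N hN) (fun x => ?_) (fun x => ?_)
    (fun ρ hρ => ?_) fun ρ hρ => ?_
  · obtain ⟨f, rfl⟩ := Submodule.Quotient.mk_surjective N x
    rw [inducedShiftSymm_mk, inducedShift_mk, ContinuousLinearEquiv.apply_symm_apply]
  · obtain ⟨f, rfl⟩ := Submodule.Quotient.mk_surjective N x
    rw [inducedShift_mk, inducedShiftSymm_mk, ContinuousLinearEquiv.symm_apply_apply]
  · obtain ⟨C, hC⟩ := exists_norm_shift_iterate_le ω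
    refine ⟨max C 0, fun m x => ?_⟩
    refine norm_quotient_iterate_le (inducedShift_mk N hN) (Real.sqrt_nonneg _)
      (fun f => (hC m f).trans ?_) x
    gcongr
    exact (le_max_left C 0).trans (le_mul_of_one_le_right (le_max_right C 0)
      (one_le_pow₀ hρ.le))
  · obtain ⟨C, hC⟩ := exists_norm_shift_symm_iterate_le ω hρ
    exact ⟨C, fun m x => norm_quotient_iterate_le (inducedShiftSymm_mk hN) (Real.sqrt_nonneg _)
      (hC m) x⟩

theorem perfect_spectrum_inducedShift (hN : IsBilaterallyInvariant N) :
    Perfect (spectrum ℂ (inducedShift N hN)) := by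
  have : IsClosed (N : Set (LaurentL2 ω)) := hN.isClosed
  refine perfect_spectrum_of_isolated_mem_resolventSet fun c hc δ hδ hres => hc ?_
  refine mem_resolventSet_of_isolated
    (e := fun n => Submodule.Quotient.mk (monomial ω n)) (w := ω.Omega) (fun n => ?_) ω.Omega_pos
    ω.Omega_mul_Omega_reflect (fun φ => summable_apply_monomial (φ.comp N.mkQL))
    (fun X hX => ?_) (by simpa using spectrum_inducedShift_subset_sphere hN hc) hδ hres
  · rw [inducedShift_mk, shift_monomial]
  · have h := eq_zero_of_apply_monomial_eq_zero (L := X.comp N.mkQL) hX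
    ext x
    obtain ⟨f, rfl⟩ := Submodule.Quotient.mk_surjective N x
    exact DFunLike.congr_fun h f

end LaurentL2

theorem mainTheorem5 (ω : RadialWeight) (N : Submodule ℂ (LaurentL2 ω))
    (hN : LaurentL2.IsBilaterallyInvariant N) :
    Perfect (spectrum ℂ (LaurentL2.inducedShift N hN)) ∧
    spectrum ℂ (LaurentL2.inducedShift N hN) ⊆ Metric.sphere (0 : ℂ) 1 ∧
    ((spectrum ℂ (LaurentL2.inducedShift N hN)).Countable →
      spectrum ℂ (LaurentL2.inducedShift N hN) = ∅ ∧ N = ⊤) := by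
  have hP := LaurentL2.perfect_spectrum_inducedShift hN
  refine ⟨hP, LaurentL2.spectrum_inducedShift_subset_sphere hN, fun hc => ?_⟩
  have h0 := hP.eq_empty_of_countable hc
  have : IsClosed (N : Set (LaurentL2 ω)) := hN.isClosed
  exact ⟨h0, Submodule.Quotient.subsingleton_iff.1 (subsingleton_of_spectrum_eq_empty h0)⟩
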